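/- Throughout, $k$ is a positive integer, and for a matrix $\gamma=\begin{pmatrix}a&b\\c&d\end{pmatrix}$ with positive determinant $(f|\gamma)(\tau)=(\det\gamma)^{k/2}(c\tau+d)^{-k}f(\gamma\tau)$ is the weight $k$ slash operator. Put $V(d)=\begin{pmatrix}d&0\\0&1\end{pmatrix}$ and $W_N=\begin{pmatrix}0&-1\\N&0\end{pmatrix}$, so $(f|V(d))(\tau)=d^{k/2}f(d\tau)$. For cusp forms $f,g$ of weight $k$ on a finite index subgroup $\Gamma\subseteq\mathrm{SL}_2(\mathbb Z)$ let $$\langle f,g\rangle=\frac{1}{[\mathrm{SL}_2(\mathbb Z):\Gamma]}\iint_{\Gamma\backslash\mathbb H}f(x+iy)\overline{g(x+iy)}\,y^k\,\frac{dx\,dy}{y^2},$$ which does not change when $\Gamma=\Gamma_0(N)$ is replaced by a smaller $\Gamma_0(N')$; thus $\langle f,f|V(d)\rangle$ is taken on $\Gamma_0(dN)$ for $f$ of level $N$. Let $\mathcal S_k^{\mathrm{new}}(\Gamma_0(N))$ be the orthogonal complement in $\mathcal S_k(\Gamma_0(N))$ of the sum of the spaces $\mathcal S_k(\Gamma_0(M))|V(d)$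 over $M\mid N$, $M<N$, $d\mid N/M$. A normalized newform of level $N$ is an $f=\sum_{n\ge1}a_f(n)e^{2\pi i n\tau}\in\mathcal S_k^{\mathrm{new}}(\Gamma_0(N))$ that is an eigenform of all Hecke operators and satisfies $a_f(1)=1$. **Lemma.** (a) If $f$ is a normalized newform of weight $k$ and level $4$, then $\langle f,f|V(2^l)\rangle=0$ for all $l\ge1$. (b) If $f$ is a normalized newform of weight $k$ and level $2$, then $f|W_2=\lambda_2(f)f$ for some $\lambda_2(f)\in\{\pm1\}$, and for all $l\ge0$ $$\langle f,f|V(2^l)\rangle=\left(-\frac{\lambda_2(f)}{2}\right)^l\langle f,f\rangle.$$ (c) If $f$ is a normalized newform of weight $k$ and level $1$, then $$\langle f,f|V(2)\rangle=\frac13\cdot\frac{a_f(2)}{2^{k/2-1}}\langle f,f\rangle,$$ $$\langle f,f|V(4)\rangle=\left(\frac16\cdot\frac{a_f(2)^2}{4^{k/2-1}}-\frac12\right)\langle f,f\rangle,$$ $$\langle f,f|V(8)\rangle=\left(\frac1{12}\cdot\frac{a_f(2)^3}{8^{k/2-1}}-\frac5{12}\cdot\frac{a_f(2)}{2^{k/2-1}}\right)\langle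 f,f\rangle,$$ $$\langle f,f|V(16)\rangle=\left(\frac1{24}\cdot\frac{a_f(2)^4}{16^{k/2-1}}-\frac7{24}\cdot\frac{a_f(2)^2}{4^{k/2-1}}+\frac14\right)\langle f,f\rangle.$$ -/

import Mathlib

open UpperHalfPlane MeasureTheory CongruenceSubgroup
open scoped MatrixGroups Modular

noncomputable section

namespace VNewform

/-- The space `S_k(Γ₀(N))` of holomorphic cusp forms of weight `k` and level `N`. -/
abbrev CuspSpace (N : ℕ) (k : ℤ) : Type :=
  CuspForm ((Gamma0 N).map (Matrix.SpecialLinearGroup.mapGL ℝ)) k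

/-- The weight `k` slash operator for matrices `γ = (a b; c d)` of positive determinant, normalized
by `det ^ (k / 2)`: `(f |_k γ)(τ) = (det γ) ^ (k / 2) (c τ + d) ^ (-k) f (γ τ)`.
(Mathlib's slash operator has the factor `det ^ (k - 1)` instead.) -/
def slash (k : ℤ) (f : ℍ → ℂ) (γ : GL (Fin 2) ℝ) : ℍ → ℂ := fun τ ↦
  (((γ.det.val : ℝ) ^ ((k : ℝ) / 2) : ℝ) : ℂ) * denom γ τ ^ (-k) * f (γ • τ)

/-- The matrix `V(d) = (d 0; 0 1)`. -/
def matV (d : ℕ+) : GL (Fin 2) ℝ :=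
  Matrix.GeneralLinearGroup.mkOfDetNeZero !![(d : ℝ), 0; 0, 1] (by simp)

/-- The matrix `W_N = (0 -1; N 0)` of the Fricke involution. -/
def matW (N : ℕ+) : GL (Fin 2) ℝ :=
  Matrix.GeneralLinearGroup.mkOfDetNeZero !![0, -1; (N : ℝ), 0] (by simp)

/-- The matrix `(1 b; 0 d)`. -/
def matB (b : ℕ) (d : ℕ+) : GL (Fin 2) ℝ :=
  Matrix.GeneralLinearGroup.mkOfDetNeZero !![1, (b : ℝ); 0, (d : ℝ)] (by simp)

/-- The Petersson inner product of weight `k` for a subgroup `Γ` of `SL(2, ℤ)`,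
`[SL(2, ℤ) : Γ]⁻¹ ∫_{Γ \ ℍ} f(τ) conj(g(τ)) y ^ k dx dy / y ^ 2`.
The integral over `Γ \ ℍ` is the integral over the union of the translates `γ 𝒟` of the standard
fundamental domain `𝒟` of `SL(2, ℤ)`, for `γ = s⁻¹` with `s` running through representatives of the
cosets `s Γ` (so that `γ` represents the cosets `Γ γ`). `volume` on `ℍ` is `dx dy / y ^ 2`, and
`petersson k g f τ` is `conj (g τ) * f τ * y ^ k`. -/
def pet (Γ : Subgroup SL(2, ℤ)) (k : ℤ) (f g : ℍ → ℂ) : ℂ :=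
  (Γ.index : ℂ)⁻¹ *
    ∑ᶠ s : SL(2, ℤ) ⧸ Γ, ∫ τ in 𝒟, petersson k g f ((Quotient.out s)⁻¹ • τ)

/-- The `n`-th Fourier coefficient of `f(τ) = ∑ a(n) e^{2πinτ}`. -/
def coeff (f : ℍ → ℂ) (n : ℕ) : ℂ := (qExpansion 1 f).coeff n

/-- The space of oldforms of level `N`: the sum of the spaces `S_k(Γ₀(M)) | V(d)` over `M < N`
and `d` with `M ∣ N` and `d ∣ N / M`. -/
def oldSpace (N : ℕ) (k : ℤ) : Submodule ℂ (ℍ → ℂ) :=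
  Submodule.span ℂ {h | ∃ (M : ℕ) (d : ℕ+) (g : CuspSpace M k),
    M < N ∧ M * (d : ℕ) ∣ N ∧ h = slash k g (matV d)}

/-- The Hecke operator `T(p)` (`p` prime) of weight `k` and level `N` with trivial character:
`T(p) f = p ^ (k / 2 - 1) (∑_{0 ≤ b < p} f | (1 b; 0 p) + [p ∤ N] f | (p 0; 0 1))`, which
on Fourier coefficients is `a(n) ↦ a(p n) + [p ∤ N] p ^ (k - 1) a(n / p)`. -/
def heckeT (N : ℕ) (k : ℤ) (p : ℕ+) (f : ℍ → ℂ) : ℍ → ℂ :=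
  ((((p : ℕ) : ℝ) ^ ((k : ℝ) / 2 - 1) : ℝ) : ℂ) •
    ((∑ b ∈ Finset.range p, slash k f (matB b p)) +
      if (p : ℕ) ∣ N then 0 else slash k f (matV p))

/-- A normalized newform of weight `k` and level `N`: an element of `S_k(Γ₀(N))` that is orthogonal
to all oldforms, is an eigenform of all Hecke operators (equivalently, of `T(p)` for all primes `p`,
including those dividing `N`), and has `a(1) = 1`. -/
structure IsNormalizedNewform (N : ℕ) (k : ℤ) (f : CuspSpace N k) : Prop where
  new : ∀ h ∈ oldSpace N k, pet (Gamma0 N) k f h = 0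
  eigen : ∀ p : ℕ+, (p : ℕ).Prime → ∃ c : ℂ, heckeT N k p f = c • (f : ℍ → ℂ)
  normalized : coeff f 1 = 1

/-- The inner product `⟨f, f | V(d)⟩` of a form `f` of level `N` with `f | V(d)`, taken
on `Γ₀(d N)`, on which both are modular. -/
def petV (N : ℕ) (k : ℤ) (f : ℍ → ℂ) (d : ℕ+) : ℂ :=
  pet (Gamma0 (d * N)) k f (slash k f (matV d))

end VNewform

end

noncomputable section

namespace VNewform

open scoped Pointwise ModularForm Manifold
open Matrix.SpecialLinearGroup (mapGL)

/-! Write `U` for `f ↦ ∑_b f | (1 b; 0 2)`. Everything rests on one adjunction, `petInner_sum_matB`: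
for `g` invariant under `T`, `⟨U f, g⟩ = 2 ⟨f, g | V(2)⟩`. It follows from the invariance of the
level-independent inner product under rational matrices of positive determinant (`petInner_slash`),
since `(1 0; 0 2)` is inverse to `V(2)` up to a scalar and the two summands of `U f` differ by `T`.

At even level a newform satisfies `U f = μ f`, so each further `V(2)` multiplies the inner product
by `μ / 2` (`petInner_matV_two_pow`). At level 4, `U f` has level 2, so `μ ≠ 0` would make `f` old
and orthogonal to itself; hence `μ = 0`. At level 2, `U f + f | W_2` has level 1; pairing it with
itself gives three times an inner product of `f` with an oldform, so it vanishes and `f | W_2 = -μ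
f` (`trace_eq_zero`).

At level 1 the eigenvalue equation is `U f + f | V(2) = μ f`. Pairing it with `f | V(2 ^ l)` gives a
three-term recursion in `l` (`petInner_levelOne_recursion`), and `heckeT_two_eigenvalue` expresses
`μ` by `a_f(2)`.

The analytic core is `stabMean_comp_smul`: a rational matrix carries a fundamental domain of one
finite index group to that of a conjugate group, and both groups have the same covolume. -/

/-! ### Invariant measure and the standard fundamental domain -/

/-- The action of the modular group on `ℍ` by permutations. -/
def modPerm : SL(2, ℤ) →* Equiv.Perm ℍ := MulAction.toPermHom SL(2, ℤ) ℍ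

@[simp] lemma modPerm_apply (γ : SL(2, ℤ)) (τ : ℍ) : modPerm γ τ = γ • τ := rfl

lemma measurePreserving_smul_GL (g : GL (Fin 2) ℝ) :
    MeasurePreserving (fun τ : ℍ ↦ g • τ) volume volume :=
  measurePreserving_smul g volume

lemma measurePreserving_smul_SL (g : SL(2, ℤ)) :
    MeasurePreserving (fun τ : ℍ ↦ g • τ) volume volume :=
  measurePreserving_smul_GL (mapGL ℝ g)

lemma volume_re_eq (c : ℝ) : volume {z : ℂ | z.re = c} = 0 := by
  have h := Complex.volume_preserving_equiv_real_prod
  have : {z : ℂ | z.re = c} = Complex.measurableEquivRealProd ⁻¹' ({c} ×ˢ Set.univ) := by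
    ext z; simp
  rw [this, h.measure_preimage_equiv, Measure.volume_eq_prod, Measure.prod_prod]
  simp

lemma volume_eq_zero_of_image {s : Set ℍ} (h : volume ((↑) '' s : Set ℂ) = 0) : volume s = 0 := by
  rw [volume_eq_lintegral, Measure.restrict_eq_zero.mpr h]
  simp

lemma volume_fd_diff_fdo : volume (𝒟 \ 𝒟ᵒ : Set ℍ) = 0 := by
  refine volume_eq_zero_of_image (measure_mono_null
    (t := Metric.sphere (0 : ℂ) 1 ∪ ({z : ℂ | z.re = 1 / 2} ∪ {z : ℂ | z.re = -(1 / 2)})) ?_ ?_)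
  · rintro _ ⟨z, ⟨⟨h1, h2⟩, h3⟩, rfl⟩
    by_cases h : Complex.normSq (z : ℂ) = 1
    · left
      rw [Complex.normSq_eq_norm_sq] at h
      have := norm_nonneg (z : ℂ)
      simp only [mem_sphere_iff_norm, sub_zero]
      nlinarith
    · right
      have h4 : 1 < Complex.normSq (z : ℂ) := lt_of_le_of_ne h1 (Ne.symm h)
      have h5 : |z.re| = 1 / 2 := by
        refine le_antisymm h2 (not_lt.mp fun h6 ↦ h3 ⟨h4, h6⟩)
      rcases eq_or_eq_neg_of_abs_eq h5 with h | h
      · left; exact h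
      · right; exact h
  · simp only [measure_union_null_iff]
    exact ⟨Measure.addHaar_sphere _ _ _, volume_re_eq _, volume_re_eq _⟩

/-- The domain lies in the strip `|x| ≤ 1/2`, `y > 1/2`, where `y ^ (-2)` is integrable. -/
lemma volume_fd_lt_top : volume (𝒟 : Set ℍ) < ⊤ := by
  rw [volume_eq_lintegral]
  have hsub : ((↑) '' (𝒟 : Set ℍ) : Set ℂ) ⊆
      Complex.measurableEquivRealProd ⁻¹' (Set.Icc (-(1/2)) (1/2) ×ˢ Set.Ioi (1/2)) := by
    rintro _ ⟨z, hz, rfl⟩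
    have h1 := ModularGroup.three_le_four_mul_im_sq_of_mem_fd hz
    have h2 := z.im_pos
    have h3 := abs_le.mp hz.2
    simp only [Set.mem_preimage, Complex.measurableEquivRealProd_apply, Set.mem_prod, Set.mem_Icc,
      Set.mem_Ioi]
    exact ⟨h3, by change 1 / 2 < z.im; nlinarith⟩
  refine (lintegral_mono_set hsub).trans_lt ?_
  have h := Complex.volume_preserving_equiv_real_prod
  have := h.setLIntegral_comp_preimage_emb (Complex.measurableEquivRealProd.measurableEmbedding)
    (fun p : ℝ × ℝ ↦ (↑((1 / ‖p.2‖₊) ^ 2 : NNReal) : ENNReal))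
    (Set.Icc (-(1/2)) (1/2) ×ˢ Set.Ioi (1/2))
  simp only [Complex.measurableEquivRealProd_apply] at this
  rw [this, Measure.volume_eq_prod, ← Measure.prod_restrict]
  rw [lintegral_prod _ (by fun_prop)]
  simp only [lintegral_const]
  refine ENNReal.mul_lt_top ?_ (by simp)
  have hi : IntegrableOn (fun y : ℝ ↦ y ^ (-2 : ℝ)) (Set.Ioi (1/2)) :=
    integrableOn_Ioi_rpow_of_lt (by norm_num) (by norm_num)
  refine lt_of_le_of_lt (setLIntegral_mono' measurableSet_Ioi fun y hy ↦ ?_) hi.2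
  have hy0 : 0 < y := lt_trans (by norm_num) hy
  rw [enorm_eq_nnnorm, ENNReal.coe_le_coe, ← NNReal.coe_le_coe]
  simp [Real.rpow_neg hy0.le, abs_of_pos hy0]

lemma aedisjoint_smul_fd {g : SL(2, ℤ)} (h1 : g ≠ 1) (h2 : g ≠ -1) :
    volume ((g • 𝒟 : Set ℍ) ∩ 𝒟) = 0 := by
  refine measure_mono_null ?_ volume_fd_diff_fdo
  rintro x ⟨hx, hx'⟩
  refine ⟨hx', fun hxo ↦ ?_⟩
  rw [Set.mem_smul_set_iff_inv_smul_mem] at hx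
  rcases ModularGroup.eq_one_or_neg_one_of_mem_fdo_mem_fd hxo hx with h | h
  · exact h1 (by simpa using h)
  · exact h2 (by rw [← inv_inv g, h]; simp [inv_neg])

/-! ### Fundamental domains of finite index subgroups -/

/-- The union of the translates of `𝒟` by the inverses of the representatives of the cosets
`s Γ`: a fundamental domain of `Γ` if `-1 ∈ Γ`. -/
def fundSet (Γ : Subgroup SL(2, ℤ)) : Set ℍ :=
  ⋃ s : SL(2, ℤ) ⧸ Γ, (Quotient.out s)⁻¹ • (𝒟 : Set ℍ)

/-- The mean value over `Γ \ ℍ` of a `Γ`-invariant function, scaled by the volume of `𝒟`. -/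
def mean (Γ : Subgroup SL(2, ℤ)) (φ : ℍ → ℂ) : ℂ :=
  (Γ.index : ℂ)⁻¹ * ∑ᶠ s : SL(2, ℤ) ⧸ Γ, ∫ τ in 𝒟, φ ((Quotient.out s)⁻¹ • τ)

lemma pet_eq_mean (Γ : Subgroup SL(2, ℤ)) (k : ℤ) (f g : ℍ → ℂ) :
    pet Γ k f g = mean Γ (petersson k g f) := rfl

lemma measurableSet_fd : MeasurableSet (𝒟 : Set ℍ) := ModularGroup.isClosed_fd.measurableSet

lemma measurableSet_smul_fd (g : SL(2, ℤ)) : MeasurableSet (g • 𝒟 : Set ℍ) := by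
  have : (g • 𝒟 : Set ℍ) = (fun τ ↦ g⁻¹ • τ) ⁻¹' 𝒟 := by
    ext x; simp [Set.mem_smul_set_iff_inv_smul_mem]
  rw [this]
  exact (measurePreserving_smul_SL g⁻¹).measurable measurableSet_fd

lemma aedisjoint_smul_smul_fd {g h : SL(2, ℤ)} (h1 : h⁻¹ * g ≠ 1) (h2 : h⁻¹ * g ≠ -1) :
    AEDisjoint volume (g • 𝒟 : Set ℍ) (h • 𝒟) := by
  have key := (measurePreserving_smul_SL h⁻¹).measure_preimage
    (((measurableSet_smul_fd (h⁻¹ * g)).inter measurableSet_fd).nullMeasurableSet)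
  rw [aedisjoint_smul_fd h1 h2] at key
  rw [AEDisjoint, ← key]
  congr 1
  ext x
  simp only [Set.mem_inter_iff, Set.mem_smul_set_iff_inv_smul_mem, Set.mem_preimage, mul_inv_rev,
    inv_inv, smul_smul, mul_inv_cancel_right]

lemma measure_smul_fd (g : SL(2, ℤ)) : volume (g • 𝒟 : Set ℍ) = volume (𝒟 : Set ℍ) := by
  have : (g • 𝒟 : Set ℍ) = (fun τ ↦ g⁻¹ • τ) ⁻¹' 𝒟 := by
    ext x; simp [Set.mem_smul_set_iff_inv_smul_mem]
  rw [this, (measurePreserving_smul_SL g⁻¹).measure_preimage measurableSet_fd.nullMeasurableSet]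

lemma modPerm_neg_one : modPerm (-1) = 1 := by
  ext τ : 1
  simp

/-- Serves both disjointness claims: with `γ = 1` for the tiles of `fundSet`, with general `γ` for
its translates. -/
lemma quotient_eq_of_out_mul_eq {Γ : Subgroup SL(2, ℤ)} (hΓ : -1 ∈ Γ) {s t : SL(2, ℤ) ⧸ Γ}
    {γ ε : SL(2, ℤ)} (hγ : γ ∈ Γ) (hε : ε = 1 ∨ ε = -1)
    (h : Quotient.out t * (γ * (Quotient.out s)⁻¹) = ε) : s = t ∧ γ = ε := by
  have hc : ∀ x : SL(2, ℤ), ε * x = x * ε := by rcases hε with rfl | rfl <;> simp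
  have e : Quotient.out t = Quotient.out s * (ε * γ⁻¹) := by
    rw [← mul_assoc, ← hc, ← h]; group
  have hst : s = t := by
    rw [← QuotientGroup.out_eq' s, ← QuotientGroup.out_eq' t]
    refine QuotientGroup.eq.mpr ?_
    rw [e, inv_mul_cancel_left]
    refine Γ.mul_mem ?_ (Γ.inv_mem hγ)
    rcases hε with rfl | rfl
    exacts [Γ.one_mem, hΓ]
  subst hst
  refine ⟨rfl, ?_⟩
  have : ε * γ⁻¹ = 1 := by simpa using e
  exact (mul_inv_eq_one.mp this).symm

lemma pairwise_aedisjoint_fundSet {Γ : Subgroup SL(2, ℤ)} (hΓ : -1 ∈ Γ) :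
    Pairwise (Function.onFun (AEDisjoint volume)
      fun s : SL(2, ℤ) ⧸ Γ ↦ ((Quotient.out s)⁻¹ • 𝒟 : Set ℍ)) := by
  intro s t hst
  have key : ∀ ε : SL(2, ℤ), ε = 1 ∨ ε = -1 →
      (Quotient.out t)⁻¹⁻¹ * (Quotient.out s)⁻¹ ≠ ε := fun ε hε h ↦
    hst (quotient_eq_of_out_mul_eq hΓ Γ.one_mem hε (by simpa using h)).1
  exact aedisjoint_smul_smul_fd (key _ (.inl rfl)) (key _ (.inr rfl))

lemma measurableConstSMul_of_le {H : Subgroup (Equiv.Perm ℍ)} (hH : H ≤ modPerm.range) :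
    MeasurableConstSMul H ℍ where
  measurable_const_smul p := by
    obtain ⟨γ, hγ⟩ := hH p.2
    convert! (measurePreserving_smul_SL γ).measurable using 1
    ext τ : 1
    rw [Subgroup.smul_def, ← hγ]; rfl

lemma smulInvariantMeasure_of_le {H : Subgroup (Equiv.Perm ℍ)} (hH : H ≤ modPerm.range) :
    SMulInvariantMeasure H ℍ volume where
  measure_preimage_smul p s hs := by
    obtain ⟨γ, hγ⟩ := hH p.2
    convert (measurePreserving_smul_SL γ).measure_preimage hs.nullMeasurableSet using 3
    ext τ : 1
    rw [Subgroup.smul_def, ← hγ]; rfl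

lemma countable_of_le {H : Subgroup (Equiv.Perm ℍ)} (hH : H ≤ modPerm.range) : Countable H := by
  have : Countable (Matrix (Fin 2) (Fin 2) ℤ) := inferInstanceAs (Countable (Fin 2 → Fin 2 → ℤ))
  have : Countable SL(2, ℤ) := Subtype.countable
  have : Countable modPerm.range := Set.countable_range modPerm
  exact (Subgroup.inclusion_injective hH).countable

lemma neg_one_mem_comap (H : Subgroup (Equiv.Perm ℍ)) : -1 ∈ H.comap modPerm := by
  rw [Subgroup.mem_comap, modPerm_neg_one]
  exact H.one_mem

/-- The group consists of permutations of `ℍ`, not of matrices: `-1` acts trivially, so the matrix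
group would violate the disjointness of translates by nontrivial elements. -/
lemma isFundamentalDomain_fundSet {H : Subgroup (Equiv.Perm ℍ)} (hH : H ≤ modPerm.range)
    [(H.comap modPerm).FiniteIndex] : IsFundamentalDomain H (fundSet (H.comap modPerm)) := by
  have := measurableConstSMul_of_le hH
  have := smulInvariantMeasure_of_le hH
  refine .mk'' ?_ ?_ ?_ fun p ↦ (measurePreserving_smul p volume).quasiMeasurePreserving
  · exact (MeasurableSet.iUnion fun s ↦ measurableSet_smul_fd _).nullMeasurableSet
  · refine .of_forall fun x ↦ ?_
    obtain ⟨g, hg⟩ := ModularGroup.exists_smul_mem_fd x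
    obtain ⟨h, hh⟩ := QuotientGroup.mk_out_eq_mul (H.comap modPerm) g
    refine ⟨⟨modPerm (h : SL(2, ℤ))⁻¹, (H.comap modPerm).inv_mem h.2⟩,
      Set.mem_iUnion.mpr ⟨(g : SL(2, ℤ) ⧸ H.comap modPerm), ?_⟩⟩
    rw [Set.mem_smul_set_iff_inv_smul_mem, inv_inv]
    change (Quotient.out (QuotientGroup.mk g : SL(2, ℤ) ⧸ H.comap modPerm)) •
      ((h : SL(2, ℤ))⁻¹ • x) ∈ _
    rw [hh, smul_smul, mul_inv_cancel_right]
    exact hg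
  · intro p hp
    obtain ⟨γ, hγ⟩ := hH p.2
    have e : p • fundSet (H.comap modPerm) =
        ⋃ s : SL(2, ℤ) ⧸ H.comap modPerm, (γ * (Quotient.out s)⁻¹) • (𝒟 : Set ℍ) := by
      rw [fundSet, Set.smul_set_iUnion]
      refine Set.iUnion_congr fun s ↦ ?_
      rw [mul_smul]
      ext x
      simp only [Set.mem_smul_set]
      constructor
      · rintro ⟨y, hy, rfl⟩
        exact ⟨y, hy, by rw [Subgroup.smul_def, ← hγ]; rfl⟩
      · rintro ⟨y, hy, rfl⟩
        exact ⟨y, hy, by rw [Subgroup.smul_def, ← hγ]; rfl⟩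
    rw [e, fundSet, AEDisjoint.iUnion_left_iff]
    intro s
    rw [AEDisjoint.iUnion_right_iff]
    intro t
    have key : ∀ ε : SL(2, ℤ), ε = 1 ∨ ε = -1 →
        (Quotient.out t)⁻¹⁻¹ * (γ * (Quotient.out s)⁻¹) ≠ ε := by
      intro ε hε h
      rw [inv_inv] at h
      have hγε := (quotient_eq_of_out_mul_eq (neg_one_mem_comap H)
        (by rw [Subgroup.mem_comap, hγ]; exact p.2) hε h).2
      apply hp
      ext1
      rw [← hγ, hγε]
      rcases hε with rfl | rfl
      · simp
      · rw [modPerm_neg_one]; rfl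
    exact aedisjoint_smul_smul_fd (key _ (.inl rfl)) (key _ (.inr rfl))

lemma integrableOn_smul_fd {φ : ℍ → ℂ} (hφ : Continuous φ) {C : ℝ} (hC : ∀ τ, ‖φ τ‖ ≤ C)
    (g : SL(2, ℤ)) : IntegrableOn φ (g • 𝒟 : Set ℍ) :=
  Measure.integrableOn_of_bounded (by rw [measure_smul_fd]; exact volume_fd_lt_top.ne)
    hφ.aestronglyMeasurable (.of_forall hC)

lemma setIntegral_fundSet {Γ : Subgroup SL(2, ℤ)} [Γ.FiniteIndex] (hΓ : -1 ∈ Γ) {φ : ℍ → ℂ}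
    (hφ : Continuous φ) {C : ℝ} (hC : ∀ τ, ‖φ τ‖ ≤ C) :
    ∫ τ in fundSet Γ, φ τ = ∑ᶠ s : SL(2, ℤ) ⧸ Γ, ∫ τ in 𝒟, φ ((Quotient.out s)⁻¹ • τ) := by
  have := Fintype.ofFinite (SL(2, ℤ) ⧸ Γ)
  rw [finsum_eq_sum_of_fintype, fundSet,
    integral_iUnion_ae (fun s ↦ (measurableSet_smul_fd _).nullMeasurableSet)
      (pairwise_aedisjoint_fundSet hΓ), tsum_fintype]
  · refine Finset.sum_congr rfl fun s _ ↦ ?_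
    set g := (Quotient.out s)⁻¹
    have e : (fun τ : ℍ ↦ mapGL ℝ g • τ) ⁻¹' (g • (𝒟 : Set ℍ)) = 𝒟 := by
      ext x
      exact Set.smul_mem_smul_set_iff (a := g)
    have h := (measurePreserving_smul_GL (mapGL ℝ g)).setIntegral_preimage_emb
      (measurableEmbedding_const_smul (mapGL ℝ g)) φ (g • (𝒟 : Set ℍ))
    rw [← h, e]
    rfl
  · exact integrableOn_finite_iUnion.mpr fun s ↦ integrableOn_smul_fd hφ hC _

lemma volume_fundSet {Γ : Subgroup SL(2, ℤ)} [Γ.FiniteIndex] (hΓ : -1 ∈ Γ) :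
    volume (fundSet Γ) = Γ.index * volume (𝒟 : Set ℍ) := by
  have := Fintype.ofFinite (SL(2, ℤ) ⧸ Γ)
  rw [fundSet, measure_iUnion₀ (pairwise_aedisjoint_fundSet hΓ)
    (fun s ↦ (measurableSet_smul_fd _).nullMeasurableSet)]
  simp [measure_smul_fd, tsum_fintype, Subgroup.index, Nat.card_eq_fintype_card]

instance : (volume : Measure ℍ).IsOpenPosMeasure := by
  have h := Measure.IsOpenPosMeasure.comap (volume : Measure ℂ) isOpenEmbedding_coe
  refine Measure.AbsolutelyContinuous.isOpenPosMeasure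
    (μ := volume.comap UpperHalfPlane.coe) ?_
  rw [volume_def]
  refine withDensity_absolutelyContinuous' ?_ (.of_forall fun z ↦ ?_)
  · have h1 : Continuous fun z : ℍ ↦ NNReal.mk z.im z.im_pos.le := continuous_im.subtype_mk _
    have h2 : Continuous fun z : ℍ ↦ (1 / NNReal.mk z.im z.im_pos.le) ^ 2 :=
      (continuous_const.div₀ h1 fun z ↦ NNReal.ne_iff.mp z.im_ne_zero).pow 2
    exact h2.measurable.coe_nnreal_ennreal.aemeasurable
  · have : NNReal.mk z.im z.im_pos.le ≠ 0 := NNReal.ne_iff.mp z.im_ne_zero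
    exact ENNReal.coe_ne_zero.mpr (pow_ne_zero 2 (one_div_ne_zero this))

/-- Needed to cancel this volume when indices are read off from covolumes. -/
lemma volume_fd_pos : volume (𝒟 : Set ℍ) ≠ 0 := by
  have := smulInvariantMeasure_of_le (le_refl modPerm.range)
  have := countable_of_le (le_refl modPerm.range)
  have htop : modPerm.range.comap modPerm = ⊤ := by ext; simp
  have : (modPerm.range.comap modPerm).FiniteIndex := by rw [htop]; infer_instance
  have hne : (volume : Measure ℍ) ≠ 0 := fun h0 ↦
    (isOpen_univ.measure_ne_zero (volume : Measure ℍ) Set.univ_nonempty) (by rw [h0]; rfl)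
  have h := (isFundamentalDomain_fundSet (le_refl modPerm.range)).measure_ne_zero hne
  rw [volume_fundSet (neg_one_mem_comap _)] at h
  exact right_ne_zero_of_mul h

/-! ### Mean values independent of the level -/

/-- The translate of an invariant function by the inverse of a representative of a coset `g Γ` does
not depend on the representative. -/
lemma apply_out_inv_smul {Γ : Subgroup SL(2, ℤ)} {φ : ℍ → ℂ}
    (hφ : ∀ γ ∈ Γ, ∀ τ, φ (γ • τ) = φ τ) (g : SL(2, ℤ)) (τ : ℍ) :
    φ ((Quotient.out (QuotientGroup.mk g : SL(2, ℤ) ⧸ Γ))⁻¹ • τ) = φ (g⁻¹ • τ) := by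
  obtain ⟨h, hh⟩ := QuotientGroup.mk_out_eq_mul Γ g
  rw [hh, mul_inv_rev, mul_smul, hφ _ (Γ.inv_mem h.2)]

/-- The mean value of an invariant function does not depend on the level. -/
lemma mean_eq_mean_of_le {Γ' Γ : Subgroup SL(2, ℤ)} [Γ'.FiniteIndex] (h : Γ' ≤ Γ) {φ : ℍ → ℂ}
    (hφ : ∀ γ ∈ Γ, ∀ τ, φ (γ • τ) = φ τ) : mean Γ' φ = mean Γ φ := by
  have : Γ.FiniteIndex := Subgroup.finiteIndex_of_le h
  have := Fintype.ofFinite (SL(2, ℤ) ⧸ Γ)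
  have := Fintype.ofFinite (SL(2, ℤ) ⧸ Γ')
  have : Finite ((SL(2, ℤ) ⧸ Γ) × (Γ ⧸ Γ'.subgroupOf Γ)) :=
    Finite.of_equiv _ (Subgroup.quotientEquivProdOfLE h)
  have : Finite (Γ ⧸ Γ'.subgroupOf Γ) :=
    Finite.of_surjective (Prod.snd : (SL(2, ℤ) ⧸ Γ) × (Γ ⧸ Γ'.subgroupOf Γ) → _)
      Prod.snd_surjective
  have := Fintype.ofFinite (Γ ⧸ Γ'.subgroupOf Γ)
  simp only [mean, finsum_eq_sum_of_fintype]
  have key : ∑ s : SL(2, ℤ) ⧸ Γ', ∫ τ in 𝒟, φ ((Quotient.out s)⁻¹ • τ) =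
      Γ'.relIndex Γ * ∑ s : SL(2, ℤ) ⧸ Γ, ∫ τ in 𝒟, φ ((Quotient.out s)⁻¹ • τ) := by
    -- The summand depends only on the coset of the larger group, and each such coset contains
    -- `Γ'.relIndex Γ` cosets of the smaller one.
    have e : ∀ s : SL(2, ℤ) ⧸ Γ', ∫ τ in 𝒟, φ ((Quotient.out s)⁻¹ • τ) =
        (fun p : (SL(2, ℤ) ⧸ Γ) × (Γ ⧸ Γ'.subgroupOf Γ) ↦
          ∫ τ in 𝒟, φ ((Quotient.out p.1)⁻¹ • τ)) (Subgroup.quotientEquivProdOfLE h s) := by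
      intro s
      induction s using QuotientGroup.induction_on with
      | H g =>
        congr 1
        ext τ
        rw [apply_out_inv_smul (fun γ hγ ↦ hφ γ (h hγ)) g]
        exact (apply_out_inv_smul hφ g τ).symm
    rw [Finset.sum_congr rfl fun s _ ↦ e s, Equiv.sum_comp (Subgroup.quotientEquivProdOfLE h)
      (fun p : (SL(2, ℤ) ⧸ Γ) × (Γ ⧸ Γ'.subgroupOf Γ) ↦
          ∫ τ in 𝒟, φ ((Quotient.out p.1)⁻¹ • τ)), Fintype.sum_prod_type]
    simp [Finset.mul_sum, Subgroup.relIndex, Subgroup.index, Nat.card_eq_fintype_card]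
  rw [key, ← Subgroup.relIndex_mul_index h]
  have h1 : Γ'.relIndex Γ ≠ 0 := fun h0 ↦ Subgroup.FiniteIndex.index_ne_zero (H := Γ') (by
    rw [← Subgroup.relIndex_mul_index h, h0, zero_mul])
  push_cast
  have h1' : (Γ'.relIndex Γ : ℂ) ≠ 0 := by exact_mod_cast h1
  field_simp

/-- The permutations of `ℍ` that leave `φ` invariant. -/
def permStab (φ : ℍ → ℂ) : Subgroup (Equiv.Perm ℍ) where
  carrier := {p | ∀ τ, φ (p τ) = φ τ}
  mul_mem' ha hb τ := by rw [Equiv.Perm.mul_apply, ha, hb]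
  one_mem' _ := rfl
  inv_mem' {p} hp τ := by rw [← hp]; simp

/-- The subgroup of the modular group that leaves `φ` invariant. -/
def modStab (φ : ℍ → ℂ) : Subgroup SL(2, ℤ) := (permStab φ).comap modPerm

lemma mem_modStab {φ : ℍ → ℂ} {γ : SL(2, ℤ)} : γ ∈ modStab φ ↔ ∀ τ, φ (γ • τ) = φ τ := Iff.rfl

/-- The mean value over `Γ \ ℍ` of a function that is invariant under some `Γ` of finite index. -/
def stabMean (φ : ℍ → ℂ) : ℂ := mean (modStab φ) φ

lemma mean_eq_stabMean {Γ : Subgroup SL(2, ℤ)} [Γ.FiniteIndex] {φ : ℍ → ℂ} (h : Γ ≤ modStab φ) :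
    mean Γ φ = stabMean φ :=
  mean_eq_mean_of_le h fun _ hγ ↦ mem_modStab.mp hγ

/-- The rational matrices in `GL(2, ℝ)`. -/
def ratGL : Subgroup (GL (Fin 2) ℝ) :=
  (Matrix.GeneralLinearGroup.map (n := Fin 2) (Rat.castHom ℝ)).range

lemma isArithmetic_conj {𝒢 : Subgroup (GL (Fin 2) ℝ)} [𝒢.IsArithmetic] {α : GL (Fin 2) ℝ}
    (hα : α ∈ ratGL) : (ConjAct.toConjAct α • 𝒢).IsArithmetic := by
  obtain ⟨g, rfl⟩ := hα
  exact Subgroup.IsArithmetic.conj 𝒢 g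

/-- The set of `γ` in the modular group such that `α γ α⁻¹` is also in the modular group. -/
def modConj (α : GL (Fin 2) ℝ) : Subgroup SL(2, ℤ) :=
  (modPerm.range.comap (MulAut.conj (MulAction.toPerm α : Equiv.Perm ℍ)).toMonoidHom).comap modPerm

/-- For rational `α` the group `α⁻¹ SL(2, ℤ) α` is commensurable with `SL(2, ℤ)`. -/
lemma finiteIndex_modConj {α : GL (Fin 2) ℝ} (hα : α ∈ ratGL) : (modConj α).FiniteIndex := by
  have := isArithmetic_conj (𝒢 := 𝒮ℒ) (ratGL.inv_mem hα)
  refine Subgroup.finiteIndex_of_le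
    (H := (ConjAct.toConjAct α⁻¹ • 𝒮ℒ : Subgroup (GL (Fin 2) ℝ)).comap (mapGL (R := ℤ) ℝ)) ?_
  intro γ hγ
  rw [Subgroup.mem_comap, map_inv, Subgroup.mem_inv_pointwise_smul_iff,
    ConjAct.toConjAct_smul] at hγ
  obtain ⟨γ', hγ'⟩ := hγ
  refine ⟨γ', ?_⟩
  ext1 τ
  change mapGL ℝ γ' • τ = α • mapGL ℝ γ • α⁻¹ • τ
  rw [hγ', mul_smul, mul_smul]

/-- The mean value is invariant under rational substitutions. -/
lemma stabMean_comp_smul {φ : ℍ → ℂ} (hφ : Continuous φ) {C : ℝ} (hC : ∀ τ, ‖φ τ‖ ≤ C)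
    {α : GL (Fin 2) ℝ} (hα : α ∈ ratGL) [(modStab φ).FiniteIndex]
    [(modStab fun τ ↦ φ (α • τ)).FiniteIndex] :
    stabMean (fun τ ↦ φ (α • τ)) = stabMean φ := by
  set a : Equiv.Perm ℍ := MulAction.toPerm α with ha
  -- `H` is cut down to the modular elements whose conjugate by `α` is again modular, so that `H' =
  -- α H α⁻¹` and both lie in the modular group.
  set H : Subgroup (Equiv.Perm ℍ) := permStab (fun τ ↦ φ (α • τ)) ⊓ modPerm.range ⊓
    modPerm.range.comap (MulAut.conj a).toMonoidHom with hH
  set H' : Subgroup (Equiv.Perm ℍ) := permStab φ ⊓ modPerm.range ⊓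
    modPerm.range.comap (MulAut.conj a⁻¹).toMonoidHom with hH'
  have hle : H ≤ modPerm.range := inf_le_left.trans inf_le_right
  have hle' : H' ≤ modPerm.range := inf_le_left.trans inf_le_right
  have hfi : (H.comap modPerm).FiniteIndex := by
    have := finiteIndex_modConj hα
    refine Subgroup.finiteIndex_of_le (H := modStab (fun τ ↦ φ (α • τ)) ⊓ modConj α) ?_
    exact fun γ hγ ↦ ⟨⟨hγ.1, ⟨γ, rfl⟩⟩, hγ.2⟩
  have hfi' : (H'.comap modPerm).FiniteIndex := by
    have := finiteIndex_modConj (ratGL.inv_mem hα)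
    refine Subgroup.finiteIndex_of_le (H := modStab φ ⊓ modConj α⁻¹) ?_
    exact fun γ hγ ↦ ⟨⟨hγ.1, ⟨γ, rfl⟩⟩, hγ.2⟩
  have hmp := measurePreserving_smul_GL α
  have hemb := measurableEmbedding_const_smul (α := ℍ) α
  have := measurableConstSMul_of_le hle'
  have := smulInvariantMeasure_of_le hle'
  have := countable_of_le hle'
  let e : H' ≃ H :=
    { toFun p := ⟨a⁻¹ * p * a, by
        obtain ⟨⟨h1, h2⟩, h3⟩ := p.2
        refine ⟨⟨fun τ ↦ ?_, by simpa using h3⟩, ?_⟩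
        · have := h1 (a τ)
          change φ (a (a⁻¹ (p.1 (a τ)))) = φ (a τ)
          simpa using this
        · simpa [mul_assoc] using h2⟩
      invFun p := ⟨a * p * a⁻¹, by
        obtain ⟨⟨h1, h2⟩, h3⟩ := p.2
        refine ⟨⟨fun τ ↦ ?_, by simpa using h3⟩, ?_⟩
        · have := h1 (a⁻¹ τ)
          change φ (a (p.1 (a⁻¹ τ))) = φ (a (a⁻¹ τ)) at this
          simpa using this
        · simpa [mul_assoc] using h2⟩
      left_inv p := by ext1; simp [mul_assoc]
      right_inv p := by ext1; simp [mul_assoc] }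
  have hF := (isFundamentalDomain_fundSet hle).image_of_equiv (H := H') a
    (measurePreserving_smul_GL α⁻¹).quasiMeasurePreserving e (fun p τ ↦ by
      change a (a⁻¹ (p.1 (a τ))) = p.1 (a τ)
      simp)
  have hF' := isFundamentalDomain_fundSet hle'
  have hpre : (fun τ : ℍ ↦ α • τ) ⁻¹' (a '' fundSet (H.comap modPerm)) =
      fundSet (H.comap modPerm) := Set.preimage_image_eq _ a.injective
  -- Two fundamental domains of `H'` have equal volume and `α` preserves volume, so the two indices,
  -- hence the normalizing factors, agree.
  have hvol := hF.measure_eq hF'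
  rw [← hmp.measure_preimage_emb hemb, hpre, volume_fundSet (neg_one_mem_comap _),
    volume_fundSet (neg_one_mem_comap _)] at hvol
  have hidx : (H.comap modPerm).index = (H'.comap modPerm).index := by
    have := (ENNReal.mul_left_inj volume_fd_pos volume_fd_lt_top.ne).mp hvol
    exact_mod_cast this
  have hint := hF.setIntegral_eq hF' (f := φ) (fun p τ ↦ p.2.1.1 τ)
  rw [← hmp.setIntegral_preimage_emb hemb, hpre,
    setIntegral_fundSet (φ := fun τ ↦ φ (α • τ)) (neg_one_mem_comap _)
      (hφ.comp (continuous_const_smul α)) (fun τ ↦ hC _),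
    setIntegral_fundSet (neg_one_mem_comap _) hφ hC] at hint
  rw [← mean_eq_stabMean (Γ := H.comap modPerm) (φ := fun τ ↦ φ (α • τ)) (fun γ hγ ↦ hγ.1.1),
    ← mean_eq_stabMean (Γ := H'.comap modPerm) (φ := φ) (fun γ hγ ↦ hγ.1.1), mean, mean, hidx]
  exact congrArg _ hint

lemma integrableOn_comp_smul_fd {φ : ℍ → ℂ} (hφ : Continuous φ) {C : ℝ} (hC : ∀ τ, ‖φ τ‖ ≤ C)
    (g : SL(2, ℤ)) : IntegrableOn (fun τ ↦ φ (g • τ)) (𝒟 : Set ℍ) :=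
  Measure.integrableOn_of_bounded volume_fd_lt_top.ne
    (hφ.comp (continuous_const_smul (mapGL ℝ g))).aestronglyMeasurable (.of_forall fun _ ↦ hC _)

lemma stabMean_add {φ ψ : ℍ → ℂ} (hφ : Continuous φ) {C : ℝ} (hC : ∀ τ, ‖φ τ‖ ≤ C)
    (hψ : Continuous ψ) {C' : ℝ} (hC' : ∀ τ, ‖ψ τ‖ ≤ C')
    [(modStab φ).FiniteIndex] [(modStab ψ).FiniteIndex] :
    stabMean (φ + ψ) = stabMean φ + stabMean ψ := by
  have := Fintype.ofFinite (SL(2, ℤ) ⧸ (modStab φ ⊓ modStab ψ))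
  rw [← mean_eq_stabMean (Γ := modStab φ ⊓ modStab ψ) inf_le_left,
    ← mean_eq_stabMean (Γ := modStab φ ⊓ modStab ψ) inf_le_right,
    ← mean_eq_stabMean (Γ := modStab φ ⊓ modStab ψ) (φ := φ + ψ) (fun γ hγ τ ↦ by
      simp only [Pi.add_apply]
      rw [hγ.1, hγ.2])]
  simp only [mean, finsum_eq_sum_of_fintype, ← mul_add, ← Finset.sum_add_distrib]
  congr 1
  refine Finset.sum_congr rfl fun s _ ↦ ?_
  exact integral_add (integrableOn_comp_smul_fd hφ hC _) (integrableOn_comp_smul_fd hψ hC' _)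

lemma stabMean_smul {φ : ℍ → ℂ} (c : ℂ) [(modStab φ).FiniteIndex] :
    stabMean (c • φ) = c * stabMean φ := by
  have := Fintype.ofFinite (SL(2, ℤ) ⧸ modStab φ)
  rw [← mean_eq_stabMean (Γ := modStab φ) (φ := c • φ) (fun γ hγ τ ↦ by
      simp only [Pi.smul_apply]
      rw [hγ])]
  simp only [stabMean, mean, finsum_eq_sum_of_fintype, mul_left_comm c, Finset.mul_sum,
    Pi.smul_apply, integral_const_mul, smul_eq_mul]

/-- The function vanishes almost everywhere on a fundamental domain, by invariance almost everywhere
on `ℍ`, and by continuity everywhere, as nonempty open sets have positive measure. -/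
lemma eq_zero_of_stabMean_eq_zero {u : ℍ → ℝ} (hu : Continuous u) (hu0 : ∀ τ, 0 ≤ u τ) {C : ℝ}
    (hC : ∀ τ, u τ ≤ C) [(modStab fun τ ↦ (u τ : ℂ)).FiniteIndex]
    (h : stabMean (fun τ ↦ (u τ : ℂ)) = 0) : u = 0 := by
  set H : Subgroup (Equiv.Perm ℍ) := permStab (fun τ ↦ (u τ : ℂ)) ⊓ modPerm.range with hH
  have hle : H ≤ modPerm.range := inf_le_right
  have hcomap : H.comap modPerm = modStab fun τ ↦ (u τ : ℂ) := by
    ext γ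
    exact ⟨fun hγ ↦ hγ.1, fun hγ ↦ ⟨hγ, ⟨γ, rfl⟩⟩⟩
  have hfi : (H.comap modPerm).FiniteIndex := by rw [hcomap]; infer_instance
  have := measurableConstSMul_of_le hle
  have := smulInvariantMeasure_of_le hle
  have := countable_of_le hle
  have hF := isFundamentalDomain_fundSet hle
  have hcont : Continuous fun τ ↦ (u τ : ℂ) := Complex.continuous_ofReal.comp hu
  have hbd : ∀ τ, ‖(u τ : ℂ)‖ ≤ C := fun τ ↦ by
    rw [Complex.norm_real, Real.norm_of_nonneg (hu0 τ)]; exact hC τ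
  have h0 : ∫ τ in fundSet (H.comap modPerm), (u τ : ℂ) = 0 := by
    rw [setIntegral_fundSet (neg_one_mem_comap _) hcont hbd]
    rw [stabMean, ← hcomap, mean] at h
    refine (mul_eq_zero.mp h).resolve_left (inv_ne_zero ?_)
    exact_mod_cast hfi.index_ne_zero
  rw [integral_complex_ofReal, Complex.ofReal_eq_zero,
    integral_eq_zero_iff_of_nonneg hu0] at h0
  · have hz : volume {τ | u τ ≠ 0} = 0 := by
      refine hF.measure_zero_of_invariant _ (fun p ↦ ?_) ?_
      · ext τ
        rw [Set.mem_smul_set_iff_inv_smul_mem]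
        have : (u ((p⁻¹ : H) • τ) : ℂ) = u τ := (p⁻¹).2.1 τ
        simp only [Set.mem_ofPred_eq, Complex.ofReal_inj.mp this]
      · have : volume.restrict (fundSet (H.comap modPerm)) {τ | u τ ≠ 0} = 0 := ae_iff.mp h0
        rwa [Measure.restrict_apply (isOpen_ne_fun hu continuous_const).measurableSet] at this
    have he := (isOpen_ne_fun hu continuous_const).measure_eq_zero_iff (volume : Measure ℍ) |>.mp hz
    ext τ
    by_contra hne
    exact Set.notMem_empty τ (he ▸ hne)
  · refine Measure.integrableOn_of_bounded (M := C) ?_ hu.aestronglyMeasurable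
      (.of_forall fun τ ↦ ?_)
    · rw [volume_fundSet (neg_one_mem_comap _)]
      exact ENNReal.mul_ne_top (by simp) volume_fd_lt_top.ne
    · rw [Real.norm_of_nonneg (hu0 τ)]; exact hC τ

/-! ### The normalized slash operator -/

/-- The factor by which the slash operator `slash` differs from the one of Mathlib. -/
def slashFactor (k : ℤ) (x : ℝ) : ℝ := x ^ ((k : ℝ) / 2) * x ^ (1 - k)

lemma slash_eq_smul (k : ℤ) (f : ℍ → ℂ) {γ : GL (Fin 2) ℝ} (hγ : 0 < γ.det.val) :
    slash k f γ = (slashFactor k γ.det.val : ℂ) • f ∣[k] γ := by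
  ext τ
  have h : (γ.det.val : ℂ) ≠ 0 := by exact_mod_cast hγ.ne'
  have e : (γ.det.val : ℂ) ^ (1 - k) * (γ.det.val : ℂ) ^ (k - 1) = 1 := by
    rw [← zpow_add₀ h]; simp
  simp only [slash, slashFactor, ModularForm.slash_apply, Pi.smul_apply, smul_eq_mul, σ, if_pos hγ,
    abs_of_pos hγ, Complex.ofReal_mul, Complex.ofReal_zpow, ContinuousAlgEquiv.refl_apply]
  linear_combination (-((γ.det.val ^ ((k : ℝ) / 2) : ℝ) : ℂ) * denom γ τ ^ (-k) * f (γ • τ)) * e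

lemma slashFactor_mul (k : ℤ) {x y : ℝ} (hx : 0 < x) (hy : 0 < y) :
    slashFactor k (x * y) = slashFactor k x * slashFactor k y := by
  rw [slashFactor, slashFactor, slashFactor, Real.mul_rpow hx.le hy.le, mul_zpow]
  ring

/-- This cancels the factor `det ^ (k - 2)` that `petersson` acquires under Mathlib's slash
operator. -/
lemma slashFactor_sq (k : ℤ) {x : ℝ} (hx : 0 < x) : slashFactor k x ^ 2 * x ^ (k - 2) = 1 := by
  have h1 : (x ^ ((k : ℝ) / 2)) ^ 2 = x ^ k := by
    rw [← Real.rpow_natCast, ← Real.rpow_mul hx.le, ← Real.rpow_intCast]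
    congr 1
    push_cast
    ring
  rw [slashFactor, mul_pow, h1, ← zpow_natCast, ← zpow_mul, ← zpow_add₀ hx.ne',
    ← zpow_add₀ hx.ne']
  have : k + (1 - k) * ((2 : ℕ) : ℤ) + (k - 2) = 0 := by push_cast; ring
  rw [this, zpow_zero]

lemma slash_mul (k : ℤ) (f : ℍ → ℂ) {A B : GL (Fin 2) ℝ} (hA : 0 < A.det.val)
    (hB : 0 < B.det.val) : slash k f (A * B) = slash k (slash k f A) B := by
  have hAB : 0 < (A * B).det.val := by
    rw [map_mul, Units.val_mul]; positivity
  rw [slash_eq_smul k f hAB, slash_eq_smul k _ hB, slash_eq_smul k f hA, SlashAction.slash_mul,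
    ModularForm.smul_slash, σ, if_pos hB, smul_smul, map_mul, Units.val_mul,
    slashFactor_mul k hA hB]
  simp [mul_comm]

lemma slash_SL (k : ℤ) (f : ℍ → ℂ) (γ : SL(2, ℤ)) : slash k f (mapGL ℝ γ) = f ∣[k] γ := by
  rw [slash_eq_smul k f (by simp), ModularForm.SL_slash]
  simp [slashFactor]
  rfl

lemma slash_smul (k : ℤ) (c : ℂ) (f : ℍ → ℂ) (γ : GL (Fin 2) ℝ) :
    slash k (c • f) γ = c • slash k f γ := by
  ext τ; simp only [slash, Pi.smul_apply, smul_eq_mul]; ring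

lemma petersson_slash_of_pos (k : ℤ) (f g : ℍ → ℂ) {α : GL (Fin 2) ℝ} (hα : 0 < α.det.val)
    (τ : ℍ) : petersson k (slash k g α) (slash k f α) τ = petersson k g f (α • τ) := by
  have h := petersson_slash k g f α τ
  rw [σ, if_pos hα, abs_of_pos hα] at h
  have e : petersson k (slash k g α) (slash k f α) τ =
      (slashFactor k α.det.val : ℂ) ^ 2 * petersson k (g ∣[k] α) (f ∣[k] α) τ := by
    rw [slash_eq_smul k f hα, slash_eq_smul k g hα]
    simp only [petersson, Pi.smul_apply, smul_eq_mul, map_mul, Complex.conj_ofReal]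
    ring
  rw [e, h, ← mul_assoc]
  have := slashFactor_sq k hα
  have h2 : (slashFactor k α.det.val : ℂ) ^ 2 * (α.det.val : ℂ) ^ (k - 2) = 1 := by
    exact_mod_cast this
  rw [h2, one_mul]
  rfl

/-! ### Cusp forms of unspecified level -/

/-- A cusp form of weight `k` for some subgroup of finite index of the modular group. -/
def IsForm (k : ℤ) (f : ℍ → ℂ) : Prop :=
  ∃ Γ : Subgroup SL(2, ℤ), Γ.FiniteIndex ∧ ∃ F : CuspForm (Γ.map (mapGL ℝ)) k, ⇑F = f

/-- The restriction of a cusp form to a smaller group. -/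
def restrictForm {𝒢 ℋ : Subgroup (GL (Fin 2) ℝ)} {k : ℤ} (h : ℋ ≤ 𝒢) (F : CuspForm 𝒢 k) :
    CuspForm ℋ k where
  toFun := F
  slash_action_eq' γ hγ := F.slash_action_eq' γ (h hγ)
  holo' := F.holo'
  zero_at_cusps' hc := F.zero_at_cusps' (hc.mono h)

lemma isForm_cuspForm {𝒢 : Subgroup (GL (Fin 2) ℝ)} [𝒢.IsArithmetic] {k : ℤ}
    (F : CuspForm 𝒢 k) : IsForm k F :=
  ⟨𝒢.comap (mapGL ℝ), inferInstance, restrictForm (Subgroup.map_comap_le _ _) F, rfl⟩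

lemma IsForm.exists_common {k : ℤ} {f g : ℍ → ℂ} (hf : IsForm k f) (hg : IsForm k g) :
    ∃ Γ : Subgroup SL(2, ℤ), Γ.FiniteIndex ∧ ∃ F G : CuspForm (Γ.map (mapGL ℝ)) k,
      ⇑F = f ∧ ⇑G = g := by
  obtain ⟨Γ, hΓ, F, rfl⟩ := hf
  obtain ⟨Γ', hΓ', G, rfl⟩ := hg
  exact ⟨Γ ⊓ Γ', inferInstance, restrictForm (Subgroup.map_mono inf_le_left) F,
    restrictForm (Subgroup.map_mono inf_le_right) G, rfl, rfl⟩

lemma IsForm.add {k : ℤ} {f g : ℍ → ℂ} (hf : IsForm k f) (hg : IsForm k g) :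
    IsForm k (f + g) := by
  obtain ⟨Γ, hΓ, F, G, rfl, rfl⟩ := hf.exists_common hg
  exact ⟨Γ, hΓ, F + G, rfl⟩

lemma IsForm.smul {k : ℤ} {f : ℍ → ℂ} (hf : IsForm k f) (c : ℂ) : IsForm k (c • f) := by
  obtain ⟨Γ, hΓ, F, rfl⟩ := hf
  exact ⟨Γ, hΓ, c • F, rfl⟩

lemma IsForm.slash {k : ℤ} {f : ℍ → ℂ} (hf : IsForm k f) {α : GL (Fin 2) ℝ} (hα : α ∈ ratGL)
    (hd : 0 < α.det.val) : IsForm k (slash k f α) := by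
  obtain ⟨Γ, hΓ, F, rfl⟩ := hf
  rw [slash_eq_smul k _ hd]
  refine IsForm.smul ?_ _
  have := isArithmetic_conj (𝒢 := Γ.map (mapGL ℝ)) (ratGL.inv_mem hα)
  exact isForm_cuspForm (CuspForm.translate F α)

lemma IsForm.mdifferentiable {k : ℤ} {f : ℍ → ℂ} (hf : IsForm k f) : MDiff f := by
  obtain ⟨Γ, hΓ, F, rfl⟩ := hf
  exact F.holo'

lemma IsForm.isZeroAt {k : ℤ} {f : ℍ → ℂ} (hf : IsForm k f) {c : OnePoint ℝ}
    (hc : IsCusp c 𝒮ℒ) : c.IsZeroAt f k := by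
  obtain ⟨Γ, hΓ, F, rfl⟩ := hf
  exact F.zero_at_cusps' ((Subgroup.IsArithmetic.isCusp_iff_isCusp_SL2Z _).mpr hc)

/-- All finite index subgroups have the same cusps, so vanishing there carries over from any level;
only invariance has to be checked. This is how forms are recognized as having lower level. -/
lemma IsForm.exists_cuspForm {k : ℤ} {f : ℍ → ℂ} (hf : IsForm k f) {Γ : Subgroup SL(2, ℤ)}
    [Γ.FiniteIndex] (h : ∀ γ ∈ Γ, f ∣[k] γ = f) :
    ∃ F : CuspForm (Γ.map (mapGL ℝ)) k, ⇑F = f :=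
  ⟨{ toFun := f
     slash_action_eq' := by rintro _ ⟨γ, hγ, rfl⟩; exact h γ hγ
     holo' := hf.mdifferentiable
     zero_at_cusps' := fun hc ↦
      hf.isZeroAt ((Subgroup.IsArithmetic.isCusp_iff_isCusp_SL2Z _).mp hc) }, rfl⟩

lemma IsForm.continuous_petersson {k : ℤ} {f g : ℍ → ℂ} (hf : IsForm k f) (hg : IsForm k g) :
    Continuous (petersson k g f) :=
  petersson_continuous k hg.mdifferentiable.continuous hf.mdifferentiable.continuous

lemma IsForm.exists_petersson_le {k : ℤ} {f g : ℍ → ℂ} (hf : IsForm k f) (hg : IsForm k g) :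
    ∃ C, ∀ τ, ‖petersson k g f τ‖ ≤ C := by
  obtain ⟨Γ, hΓ, F, G, rfl, rfl⟩ := hf.exists_common hg
  exact CuspFormClass.petersson_bounded_left k (Γ.map (mapGL ℝ)) G F

lemma IsForm.finiteIndex_modStab {k : ℤ} {f g : ℍ → ℂ} (hf : IsForm k f) (hg : IsForm k g) :
    (modStab (petersson k g f)).FiniteIndex := by
  obtain ⟨Γ, hΓ, F, G, rfl, rfl⟩ := hf.exists_common hg
  refine Subgroup.finiteIndex_of_le (H := Γ) fun γ hγ ↦ mem_modStab.mpr fun τ ↦ ?_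
  exact SlashInvariantFormClass.petersson_smul (Γ := Γ.map (mapGL ℝ)) ⟨γ, hγ, rfl⟩

/-! ### The level-independent Petersson product -/

/-- The Petersson inner product, normalized so as not to depend on the level. -/
def petInner (k : ℤ) (f g : ℍ → ℂ) : ℂ := stabMean (petersson k g f)

lemma pet_eq_petInner {k : ℤ} {f g : ℍ → ℂ} {Γ : Subgroup SL(2, ℤ)} [Γ.FiniteIndex]
    (hf : ∀ γ ∈ Γ, f ∣[k] γ = f) (hg : ∀ γ ∈ Γ, g ∣[k] γ = g) :
    pet Γ k f g = petInner k f g := by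
  rw [pet_eq_mean]
  refine mean_eq_stabMean fun γ hγ ↦ mem_modStab.mpr fun τ ↦ ?_
  have := petersson_slash_SL k g f γ τ
  rwa [hf γ hγ, hg γ hγ, eq_comm] at this

lemma petInner_add_left {k : ℤ} {f₁ f₂ g : ℍ → ℂ} (h₁ : IsForm k f₁) (h₂ : IsForm k f₂)
    (hg : IsForm k g) : petInner k (f₁ + f₂) g = petInner k f₁ g + petInner k f₂ g := by
  obtain ⟨C, hC⟩ := h₁.exists_petersson_le hg
  obtain ⟨C', hC'⟩ := h₂.exists_petersson_le hg
  have := h₁.finiteIndex_modStab hg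
  have := h₂.finiteIndex_modStab hg
  rw [petInner, petInner, petInner, ← stabMean_add (h₁.continuous_petersson hg) hC
    (h₂.continuous_petersson hg) hC']
  congr 1
  ext τ
  simp only [petersson, Pi.add_apply]
  ring

lemma petInner_smul_left {k : ℤ} {f g : ℍ → ℂ} (hf : IsForm k f) (hg : IsForm k g) (c : ℂ) :
    petInner k (c • f) g = c * petInner k f g := by
  have := hf.finiteIndex_modStab hg
  rw [petInner, petInner, ← stabMean_smul c]
  congr 1
  ext τ
  simp only [petersson, Pi.smul_apply, smul_eq_mul]
  ring

/-- The integrand of the slashed pair is the original integrand composed with `α`, and the mean is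
invariant under rational substitutions. -/
lemma petInner_slash {k : ℤ} {f g : ℍ → ℂ} (hf : IsForm k f) (hg : IsForm k g)
    {α : GL (Fin 2) ℝ} (hα : α ∈ ratGL) (hd : 0 < α.det.val) :
    petInner k (slash k f α) (slash k g α) = petInner k f g := by
  obtain ⟨C, hC⟩ := hf.exists_petersson_le hg
  have e : petersson k (slash k g α) (slash k f α) = fun τ ↦ petersson k g f (α • τ) :=
    funext fun τ ↦ petersson_slash_of_pos k f g hd τ
  have := hf.finiteIndex_modStab hg
  have : (modStab fun τ ↦ petersson k g f (α • τ)).FiniteIndex := by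
    rw [← e]
    exact (hf.slash hα hd).finiteIndex_modStab (hg.slash hα hd)
  rw [petInner, e, stabMean_comp_smul (hf.continuous_petersson hg) hC hα, petInner]

lemma eq_zero_of_petInner_self {k : ℤ} {f : ℍ → ℂ} (hf : IsForm k f)
    (h : petInner k f f = 0) : f = 0 := by
  have e : petersson k f f = fun τ ↦ ((‖f τ‖ ^ 2 * τ.im ^ k : ℝ) : ℂ) := by
    ext τ
    simp only [petersson, Complex.conj_mul']
    push_cast
    rfl
  obtain ⟨C, hC⟩ := hf.exists_petersson_le hf
  have hfi := hf.finiteIndex_modStab hf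
  rw [petInner, e] at h
  rw [e] at hC hfi
  have h0 : ∀ τ : ℍ, 0 ≤ ‖f τ‖ ^ 2 * τ.im ^ k := fun τ ↦ by
    have := τ.im_pos
    positivity
  have hc : Continuous fun τ : ℍ ↦ ‖f τ‖ ^ 2 * τ.im ^ k :=
    (hf.mdifferentiable.continuous.norm.pow 2).mul
      (continuous_im.zpow₀ k fun τ ↦ .inl τ.im_ne_zero)
  have hu := eq_zero_of_stabMean_eq_zero hc h0 (C := C) (fun τ ↦ by
    have := hC τ
    rwa [Complex.norm_real, Real.norm_of_nonneg (h0 τ)] at this) h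
  ext τ
  have := congrFun hu τ
  simpa [zpow_ne_zero k τ.im_ne_zero] using this

/-! ### Matrix identities for `V(d)`, `(1 b; 0 d)` and `W_N` -/

lemma mapGL_val (g : SL(2, ℤ)) :
    (mapGL ℝ g).val = !![(g 0 0 : ℝ), (g 0 1 : ℝ); (g 1 0 : ℝ), (g 1 1 : ℝ)] := by
  ext i j; fin_cases i <;> fin_cases j <;> simp

lemma matV_val (d : ℕ+) : (matV d).val = !![(d : ℝ), 0; 0, 1] := rfl

lemma matB_val (b : ℕ) (d : ℕ+) : (matB b d).val = !![1, (b : ℝ); 0, (d : ℝ)] := rfl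

lemma matW_val (d : ℕ+) : (matW d).val = !![0, -1; (d : ℝ), 0] := rfl

lemma det_pos_mapGL (g : SL(2, ℤ)) : 0 < (mapGL ℝ g).det.val := by simp

lemma det_pos_matV (d : ℕ+) : 0 < (matV d).det.val := by
  simp [matV, Matrix.GeneralLinearGroup.mkOfDetNeZero]

lemma det_pos_matB (b : ℕ) (d : ℕ+) : 0 < (matB b d).det.val := by
  simp [matB, Matrix.GeneralLinearGroup.mkOfDetNeZero]

lemma det_pos_matW (d : ℕ+) : 0 < (matW d).det.val := by
  simp [matW, Matrix.GeneralLinearGroup.mkOfDetNeZero]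

lemma mem_ratGL_of_val {α : GL (Fin 2) ℝ} {a b c d : ℚ}
    (h : α.val = !![(a : ℝ), (b : ℝ); (c : ℝ), (d : ℝ)]) : α ∈ ratGL := by
  have hdet : (!![a, b; c, d] : Matrix (Fin 2) (Fin 2) ℚ).det ≠ 0 := by
    intro h0
    have h1 := α.det_ne_zero
    rw [h, Matrix.det_fin_two_of] at h1
    rw [Matrix.det_fin_two_of] at h0
    exact h1 (by exact_mod_cast h0)
  refine ⟨Matrix.GeneralLinearGroup.mkOfDetNeZero _ hdet, Units.ext ?_⟩
  rw [h]
  ext i j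
  fin_cases i <;> fin_cases j <;> simp [Matrix.GeneralLinearGroup.mkOfDetNeZero]

lemma mapGL_mem_ratGL (g : SL(2, ℤ)) : mapGL ℝ g ∈ ratGL :=
  mem_ratGL_of_val (a := g 0 0) (b := g 0 1) (c := g 1 0) (d := g 1 1) (by rw [mapGL_val]; simp)

lemma matV_mem_ratGL (d : ℕ+) : matV d ∈ ratGL :=
  mem_ratGL_of_val (a := d) (b := 0) (c := 0) (d := 1) (by rw [matV_val]; simp)

lemma matB_mem_ratGL (b : ℕ) (d : ℕ+) : matB b d ∈ ratGL :=
  mem_ratGL_of_val (a := 1) (b := b) (c := 0) (d := d) (by rw [matB_val]; simp)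

lemma matW_mem_ratGL (d : ℕ+) : matW d ∈ ratGL :=
  mem_ratGL_of_val (a := 0) (b := -1) (c := d) (d := 0) (by rw [matW_val]; simp)

lemma IsForm.slash_matV {k : ℤ} {f : ℍ → ℂ} (hf : IsForm k f) (d : ℕ+) :
    IsForm k (VNewform.slash k f (matV d)) := hf.slash (matV_mem_ratGL d) (det_pos_matV d)

lemma IsForm.slash_matB {k : ℤ} {f : ℍ → ℂ} (hf : IsForm k f) (b : ℕ) (d : ℕ+) :
    IsForm k (VNewform.slash k f (matB b d)) := hf.slash (matB_mem_ratGL b d) (det_pos_matB b d)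

lemma IsForm.slash_matW {k : ℤ} {f : ℍ → ℂ} (hf : IsForm k f) (d : ℕ+) :
    IsForm k (VNewform.slash k f (matW d)) := hf.slash (matW_mem_ratGL d) (det_pos_matW d)

lemma slash_of_val_scalar (k : ℤ) (f : ℍ → ℂ) {α : GL (Fin 2) ℝ} {r : ℝ} (hr : 0 < r)
    (h : α.val = !![r, 0; 0, r]) : slash k f α = f := by
  have hd : α.det.val = r ^ 2 := by
    rw [Matrix.GeneralLinearGroup.val_det_apply, h, Matrix.det_fin_two_of]; ring
  have hdp : 0 < α.det.val := by rw [hd]; positivity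
  ext τ
  have hden : denom α τ = r := by simp [denom, h]
  have hα : α • τ = τ := by
    ext1
    rw [coe_smul_of_det_pos hdp, hden]
    have : (r : ℂ) ≠ 0 := by exact_mod_cast hr.ne'
    simp [num, h, this]
  have hpow : (r ^ 2) ^ ((k : ℝ) / 2) = r ^ k := by
    rw [← Real.rpow_natCast, ← Real.rpow_mul hr.le, ← Real.rpow_intCast]
    congr 1
    push_cast
    ring
  have : (r : ℂ) ^ k ≠ 0 := zpow_ne_zero _ (by exact_mod_cast hr.ne')
  rw [slash, hd, hpow, hden, hα, zpow_neg, Complex.ofReal_zpow]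
  field_simp

lemma slash_matV_one (k : ℤ) (f : ℍ → ℂ) : slash k f (matV 1) = f :=
  slash_of_val_scalar k f one_pos (by simp [matV_val])

/-- Moving an element of the modular group past a matrix. -/
lemma slash_slash_SL {k : ℤ} {f : ℍ → ℂ} {A B : GL (Fin 2) ℝ} (hA : 0 < A.det.val)
    (hB : 0 < B.det.val) {γ γ' : SL(2, ℤ)} (hf : f ∣[k] γ' = f)
    (h : A.val * (mapGL ℝ γ).val = (mapGL ℝ γ').val * B.val) :
    slash k f A ∣[k] γ = slash k f B := by
  have h' : A * mapGL ℝ γ = mapGL ℝ γ' * B := Units.ext h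
  rw [← slash_SL, ← slash_mul k f hA (det_pos_mapGL γ), h', slash_mul k f (det_pos_mapGL γ') hB,
    slash_SL, hf]

lemma slash_matV_mul (k : ℤ) (f : ℍ → ℂ) (d e : ℕ+) :
    slash k f (matV (d * e)) = slash k (slash k f (matV d)) (matV e) := by
  rw [← slash_mul k f (det_pos_matV d) (det_pos_matV e)]
  congr 1
  refine Units.ext ?_
  rw [Units.val_mul, matV_val, matV_val, matV_val]
  simp

lemma slash_matB_zero_matV (k : ℤ) (f : ℍ → ℂ) (d : ℕ+) :
    slash k (slash k f (matB 0 d)) (matV d) = f := by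
  rw [← slash_mul k f (det_pos_matB 0 d) (det_pos_matV d)]
  refine slash_of_val_scalar k f (r := d) (by simp) ?_
  rw [Units.val_mul, matV_val, matB_val]
  simp

lemma slash_matB_zero_T (k : ℤ) (f : ℍ → ℂ) :
    slash k f (matB 0 2) ∣[k] ModularGroup.T = slash k f (matB 1 2) :=
  slash_slash_SL (γ' := 1) (det_pos_matB _ _) (det_pos_matB _ _) (by simp) (by
    rw [mapGL_val, mapGL_val, matB_val, matB_val]; simp [ModularGroup.T])

lemma slash_matB_zero_S (k : ℤ) (f : ℍ → ℂ) :
    slash k f (matB 0 2) ∣[k] ModularGroup.S = slash k f (matW 2) :=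
  slash_slash_SL (γ' := 1) (det_pos_matB _ _) (det_pos_matW _) (by simp) (by
    rw [mapGL_val, mapGL_val, matB_val, matW_val]; simp [ModularGroup.S])

/-- `f | V(d)` has level `d N` if `f` has level `N`. -/
lemma slash_matV_invariant {k : ℤ} {f : ℍ → ℂ} {N : ℕ} (hf : ∀ γ ∈ Gamma0 N, f ∣[k] γ = f)
    (d : ℕ+) {γ : SL(2, ℤ)} (hγ : γ ∈ Gamma0 (d * N)) :
    slash k f (matV d) ∣[k] γ = slash k f (matV d) := by
  rw [Gamma0_mem, ZMod.intCast_zmod_eq_zero_iff_dvd] at hγ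
  obtain ⟨c, hc⟩ := hγ
  push_cast at hc
  have hdet := Matrix.det_fin_two γ.1
  rw [γ.2] at hdet
  have hdet' : γ 0 0 * γ 1 1 - γ 0 1 * γ 1 0 = 1 := hdet.symm
  -- This is `V(d) γ V(d)⁻¹`.
  let γ' : SL(2, ℤ) := ⟨!![γ 0 0, d * γ 0 1; N * c, γ 1 1], by
    rw [Matrix.det_fin_two_of]; linear_combination hdet' + γ 0 1 * hc⟩
  refine slash_slash_SL (γ' := γ') (det_pos_matV d) (det_pos_matV d) (hf γ' ?_) ?_
  · rw [Gamma0_mem, ZMod.intCast_zmod_eq_zero_iff_dvd]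
    exact ⟨c, rfl⟩
  · rw [mapGL_val, mapGL_val, matV_val]
    have hcR : (γ 1 0 : ℝ) = d * N * c := by exact_mod_cast hc
    simp only [γ', hcR]
    ext i j
    fin_cases i <;> fin_cases j <;> simp [mul_assoc, mul_comm]

lemma invariant_SL_of_S_T {k : ℤ} {h : ℍ → ℂ} (hS : h ∣[k] ModularGroup.S = h)
    (hT : h ∣[k] ModularGroup.T = h) (γ : SL(2, ℤ)) : h ∣[k] γ = h := by
  have hγ : γ ∈ Subgroup.closure {ModularGroup.S, ModularGroup.T} := by
    simp [SpecialLinearGroup.SL2Z_generators]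
  induction hγ using Subgroup.closure_induction with
  | mem x hx =>
    rcases hx with rfl | rfl
    exacts [hS, hT]
  | one => simp
  | mul x y _ _ hx hy => rw [SlashAction.slash_mul, hx, hy]
  | inv x _ hx =>
    nth_rw 1 [← hx]
    rw [← SlashAction.slash_mul]
    simp

/-- The operator `∑_b f | (1 b; 0 2)` lowers the level from `4` to `2`. -/
lemma sum_matB_invariant {k : ℤ} {f : ℍ → ℂ} (hf : ∀ γ ∈ Gamma0 4, f ∣[k] γ = f)
    {γ : SL(2, ℤ)} (hγ : γ ∈ Gamma0 2) :
    (slash k f (matB 0 2) + slash k f (matB 1 2)) ∣[k] γ =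
      slash k f (matB 0 2) + slash k f (matB 1 2) := by
  rw [Gamma0_mem, ZMod.intCast_zmod_eq_zero_iff_dvd] at hγ
  obtain ⟨c, hc⟩ := hγ
  push_cast at hc
  have hdet := Matrix.det_fin_two γ.1
  rw [γ.2] at hdet
  have hdet' : γ 0 0 * γ 1 1 - γ 0 1 * γ 1 0 = 1 := hdet.symm
  rw [hc] at hdet'
  have hcR : (γ 1 0 : ℝ) = 2 * c := by exact_mod_cast hc
  -- Solving `(1 i; 0 2) γ = γ' (1 j; 0 2)` for `γ'` leaves one integrality condition, on its upper
  -- right entry `x`.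
  have key : ∀ i j : ℕ, ∀ x : ℤ,
      2 * x = γ 0 1 + i * γ 1 1 - j * (γ 0 0 + i * γ 1 0) →
      slash k f (matB i 2) ∣[k] γ = slash k f (matB j 2) := by
    intro i j x hx
    rw [hc] at hx
    let γ' : SL(2, ℤ) := ⟨!![γ 0 0 + i * (2 * c), x; 4 * c, γ 1 1 - j * (2 * c)], by
      rw [Matrix.det_fin_two_of]; linear_combination hdet' - 2 * c * hx⟩
    refine slash_slash_SL (γ' := γ') (det_pos_matB i 2) (det_pos_matB j 2) (hf γ' ?_) ?_
    · rw [Gamma0_mem, ZMod.intCast_zmod_eq_zero_iff_dvd]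
      exact ⟨c, rfl⟩
    · have hxR : 2 * (x : ℝ) = γ 0 1 + i * γ 1 1 - j * (γ 0 0 + i * (2 * c)) := by
        exact_mod_cast hx
      rw [mapGL_val, mapGL_val, matB_val, matB_val]
      ext a b
      fin_cases a <;> fin_cases b <;> simp [γ', hcR, Matrix.mul_apply, Fin.sum_univ_two]
      · linear_combination -hxR
      · ring
      · ring
  have ha : γ 0 0 % 2 = 1 := by
    by_contra h
    have : γ 0 0 = 2 * (γ 0 0 / 2) := by omega
    rw [this] at hdet'
    have : 2 * (γ 0 0 / 2 * γ 1 1 - γ 0 1 * c) = 1 := by linear_combination hdet'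
    omega
  have hd : γ 1 1 % 2 = 1 := by
    by_contra h
    have : γ 1 1 = 2 * (γ 1 1 / 2) := by omega
    rw [this] at hdet'
    have : 2 * (γ 0 0 * (γ 1 1 / 2) - γ 0 1 * c) = 1 := by linear_combination hdet'
    omega
  rw [SlashAction.add_slash]
  -- As the diagonal entries of `γ` are odd, the two summands are fixed if the upper right entry is
  -- even and swapped if it is odd.
  rcases Int.emod_two_eq_zero_or_one (γ 0 1) with hb | hb
  · rw [key 0 0 (γ 0 1 / 2) (by push_cast; omega),
      key 1 1 ((γ 0 1 + γ 1 1 - γ 0 0) / 2 - c) (by push_cast; omega)]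
  · rw [key 0 1 ((γ 0 1 - γ 0 0) / 2) (by push_cast; omega),
      key 1 0 ((γ 0 1 + γ 1 1) / 2) (by push_cast; omega), add_comm]

/-! ### The operator `T(2)` on Fourier coefficients -/

lemma coe_matV_smul (d : ℕ+) (τ : ℍ) : ((matV d • τ : ℍ) : ℂ) = d * τ := by
  rw [coe_smul_of_det_pos (det_pos_matV d)]
  simp [num, denom, matV_val]

lemma coe_matB_smul (b : ℕ) (d : ℕ+) (τ : ℍ) : ((matB b d • τ : ℍ) : ℂ) = (τ + b) / d := by
  rw [coe_smul_of_det_pos (det_pos_matB b d)]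
  simp [num, denom, matB_val]

lemma heckeT_two (N : ℕ) (k : ℤ) (f : ℍ → ℂ) :
    heckeT N k 2 f = (((2 : ℝ) ^ ((k : ℝ) / 2 - 1) : ℝ) : ℂ) •
      (slash k f (matB 0 2) + slash k f (matB 1 2) +
        if 2 ∣ N then 0 else slash k f (matV 2)) := by
  split_ifs with h <;> simp [heckeT, Finset.sum_range_succ, h]

lemma heckeT_two_apply {N : ℕ} (hN : ¬ 2 ∣ N) (k : ℤ) (f : ℍ → ℂ) (τ : ℍ) :
    heckeT N k 2 f τ = 1 / 2 * (f (matB 0 2 • τ) + f (matB 1 2 • τ)) +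
      2 ^ (k - 1) * f (matV 2 • τ) := by
  have h2 : (0 : ℝ) < 2 := two_pos
  have hB : ∀ b, (matB b 2).det.val = 2 := fun b ↦ by
    rw [Matrix.GeneralLinearGroup.val_det_apply, matB_val, Matrix.det_fin_two_of]; simp
  have hV : (matV 2).det.val = 2 := by
    rw [Matrix.GeneralLinearGroup.val_det_apply, matV_val, Matrix.det_fin_two_of]; simp
  have hdB : ∀ b, denom (matB b 2) τ = 2 := fun b ↦ by simp [denom, matB_val]
  have hdV : denom (matV 2) τ = 1 := by simp [denom, matV_val]
  have e : ((2 : ℝ) ^ ((k : ℝ) / 2 - 1) : ℝ) * ((2 : ℝ) ^ ((k : ℝ) / 2) : ℝ) = 2 ^ (k - 1) := by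
    rw [← Real.rpow_add h2, ← Real.rpow_intCast]
    congr 1
    push_cast
    ring
  have eC : (((2 : ℝ) ^ ((k : ℝ) / 2 - 1) : ℝ) : ℂ) * (((2 : ℝ) ^ ((k : ℝ) / 2) : ℝ) : ℂ) =
      2 ^ (k - 1) := by
    rw [← Complex.ofReal_mul, e]; push_cast; rfl
  have e2 : (2 : ℂ) ^ (k - 1) * 2 ^ (-k) = 1 / 2 := by
    rw [← zpow_add₀ two_ne_zero, show k - 1 + -k = -1 by ring, zpow_neg_one, one_div]
  rw [heckeT_two, if_neg hN]
  simp only [Pi.smul_apply, Pi.add_apply, smul_eq_mul, slash, hB, hV, hdB, hdV, one_zpow]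
  linear_combination (2 ^ (-k) * (f (matB 0 2 • τ) + f (matB 1 2 • τ)) + f (matV 2 • τ)) * eC +
    (f (matB 0 2 • τ) + f (matB 1 2 • τ)) * e2

/-- The eigenvalue of `T(2)` on an eigenform of odd level, in terms of Fourier coefficients. -/
lemma heckeT_two_eigenvalue {N : ℕ} [NeZero N] (hN : ¬ 2 ∣ N) {k : ℤ} (f : CuspSpace N k) {c : ℂ}
    (hc : heckeT N k 2 f = c • (f : ℍ → ℂ)) : c * coeff f 1 = coeff f 2 := by
  have h1 : (1 : ℝ) ∈ ((Gamma0 N).map (mapGL ℝ)).strictPeriods := by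
    rw [strictPeriods_Gamma0]; exact AddSubgroup.mem_zmultiples 1
  set a : ℕ → ℂ := coeff f with ha
  set q : ℂ → ℂ := Function.Periodic.qParam 1 with hq
  have hsum : ∀ τ : ℍ, HasSum (fun m ↦ a m * q τ ^ m) (f τ) := fun τ ↦
    ModularForm.hasSum_qExpansion f one_pos h1 τ
  have hqadd : ∀ z : ℂ, q (z + z) = q z ^ 2 := fun z ↦ by
    simp only [hq, Function.Periodic.qParam, ← Complex.exp_nat_mul]
    congr 1
    push_cast
    ring
  have hqhalf : ∀ z : ℂ, q (z + 1 / 2) = - q z := fun z ↦ by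
    have e : 2 * (Real.pi : ℂ) * Complex.I * (z + 1 / 2) / (1 : ℝ) =
        2 * (Real.pi : ℂ) * Complex.I * z / (1 : ℝ) + Real.pi * Complex.I := by
      push_cast; ring
    simp only [hq, Function.Periodic.qParam]
    rw [e, Complex.exp_add, Complex.exp_pi_mul_I]
    ring
  have hinj : Function.Injective fun n : ℕ ↦ 2 * n := fun m n h ↦ by simpa using h
  have hnot : ∀ m : ℕ, m ∉ Set.range (fun n : ℕ ↦ 2 * n) → Odd m := fun m hm ↦ by
    by_contra h
    obtain ⟨n, rfl⟩ := Nat.not_odd_iff_even.mp h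
    exact hm ⟨n, by simp [two_mul]⟩
  let b : ℕ → ℂ := fun n ↦ a (2 * n) + 2 ^ (k - 1) * (if Even n then a (n / 2) else 0)
  have hT : ∀ τ : ℍ, HasSum (fun n ↦ b n * q τ ^ n) (heckeT N k 2 f τ) := by
    intro τ
    rw [heckeT_two_apply hN]
    have hw : q (τ / 2) ^ 2 = q τ := by rw [← hqadd, add_halves]
    have hs0 := hsum (matB 0 2 • τ)
    have hs1 := hsum (matB 1 2 • τ)
    have hs2 := hsum (matV 2 • τ)
    rw [coe_matB_smul] at hs0 hs1
    rw [coe_matV_smul] at hs2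
    have e0 : ((τ : ℂ) + (0 : ℕ)) / (2 : ℕ+) = τ / 2 := by simp
    have e1 : ((τ : ℂ) + (1 : ℕ)) / (2 : ℕ+) = τ / 2 + 1 / 2 := by
      simp; ring
    have e2 : ((2 : ℕ+) : ℂ) * τ = τ + τ := by simp; ring
    rw [e0] at hs0
    rw [e1, hqhalf] at hs1
    rw [e2, hqadd] at hs2
    -- The shift by `1/2` replaces `q(τ/2)` by its negative, so the odd powers cancel.
    have hA : HasSum (fun n ↦ a (2 * n) * q τ ^ n)
        (1 / 2 * (f (matB 0 2 • τ) + f (matB 1 2 • τ))) := by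
      have h := (hs0.add hs1).mul_left (1 / 2)
      rw [← hinj.hasSum_iff] at h
      · convert! h using 1
        funext n
        simp only [Function.comp_apply, pow_mul, hw, neg_sq]
        ring
      · intro m hm
        rw [(hnot m hm).neg_pow]
        ring
    have hB : HasSum (fun n ↦ (if Even n then a (n / 2) else 0) * q τ ^ n) (f (matV 2 • τ)) := by
      rw [← hinj.hasSum_iff]
      · convert hs2 using 1
        ext n
        simp [pow_mul]
      · intro m hm
        rw [if_neg (Nat.not_even_iff_odd.mpr (hnot m hm)), zero_mul]
    convert hA.add (hB.mul_left (2 ^ (k - 1))) using 1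
    ext n
    simp only [b]
    ring
  have hcf : ⇑(c • f) = heckeT N k 2 f := hc.symm
  -- The comparison is made at `n = 1`, which is odd, so the `a (n / 2)` term is absent.
  have hb := ModularFormClass.qExpansion_coeff_unique one_pos h1 (f := c • f) (c := b)
    (fun τ ↦ by rw [hcf]; exact hT τ) 1
  have hca := ModularFormClass.qExpansion_coeff_unique one_pos h1 (f := c • f)
    (c := fun n ↦ c * a n) (fun τ ↦ by
      have := (hsum τ).mul_left c
      simpa [mul_assoc] using this) 1
  have := hca.trans hb.symm
  simpa [b] using this

/-! ### Adjointness of `U` and `V(2)` -/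

lemma CuspSpace.slash_eq {N : ℕ} {k : ℤ} (f : CuspSpace N k) {γ : SL(2, ℤ)} (hγ : γ ∈ Gamma0 N) :
    (f : ℍ → ℂ) ∣[k] γ = f :=
  f.slash_action_eq' _ ⟨γ, hγ, rfl⟩

lemma CuspSpace.isForm {N : ℕ} [NeZero N] {k : ℤ} (f : CuspSpace N k) : IsForm k f :=
  isForm_cuspForm f

lemma T_mem_Gamma0 (N : ℕ) : ModularGroup.T ∈ Gamma0 N := by
  rw [Gamma0_mem]; simp [ModularGroup.T]

lemma mem_Gamma0_one (γ : SL(2, ℤ)) : γ ∈ Gamma0 1 :=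
  Gamma0_mem.mpr (Subsingleton.elim _ _)

/-- The inner product on `Γ₀(d N)` of a form of level `N` with its image under `V(d)`. -/
lemma petV_eq_petInner {N : ℕ} [NeZero N] {k : ℤ} (f : CuspSpace N k) (d : ℕ+) :
    petV N k f d = petInner k f (slash k f (matV d)) := by
  refine pet_eq_petInner (fun γ hγ ↦ f.slash_eq ?_) fun γ hγ ↦
    slash_matV_invariant (fun γ ↦ f.slash_eq) d hγ
  rw [Gamma0_mem, ZMod.intCast_zmod_eq_zero_iff_dvd] at hγ ⊢
  exact (by push_cast; exact dvd_mul_left _ _ : (N : ℤ) ∣ ((d * N : ℕ) : ℤ)).trans hγ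

lemma pet_Gamma0_eq_petInner {N : ℕ} [NeZero N] {k : ℤ} (f g : CuspSpace N k) :
    pet (Gamma0 N) k f g = petInner k f g :=
  pet_eq_petInner (fun _ ↦ f.slash_eq) fun _ ↦ g.slash_eq

lemma petInner_slash_SL {k : ℤ} {f g : ℍ → ℂ} (hf : IsForm k f) (hg : IsForm k g)
    (γ : SL(2, ℤ)) : petInner k (f ∣[k] γ) (g ∣[k] γ) = petInner k f g := by
  rw [← slash_SL, ← slash_SL]
  exact petInner_slash hf hg (mapGL_mem_ratGL γ) (det_pos_mapGL γ)

/-- Apply `V(d)` to both arguments: `(1 0; 0 d) V(d)` is scalar and acts trivially. -/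
lemma petInner_matB_zero {k : ℤ} {f g : ℍ → ℂ} (hf : IsForm k f) (hg : IsForm k g) (d : ℕ+) :
    petInner k (slash k f (matB 0 d)) g = petInner k f (slash k g (matV d)) := by
  rw [← petInner_slash (hf.slash_matB 0 d) hg (matV_mem_ratGL d) (det_pos_matV d),
    slash_matB_zero_matV]

/-- The operators `f ↦ ∑_b f | (1 b; 0 2)` and `g ↦ 2 g | V(2)` are adjoint to each other. -/
lemma petInner_sum_matB {k : ℤ} {f g : ℍ → ℂ} (hf : IsForm k f) (hg : IsForm k g)
    (hT : g ∣[k] ModularGroup.T = g) :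
    petInner k (slash k f (matB 0 2) + slash k f (matB 1 2)) g =
      2 * petInner k f (slash k g (matV 2)) := by
  have h1 : petInner k (slash k f (matB 1 2)) g = petInner k (slash k f (matB 0 2)) g := by
    rw [← slash_matB_zero_T]
    nth_rw 1 [← hT]
    exact petInner_slash_SL (hf.slash_matB 0 2) hg _
  rw [petInner_add_left (hf.slash_matB 0 2) (hf.slash_matB 1 2) hg, h1,
    petInner_matB_zero hf hg, two_mul]

lemma slash_matV_T {N : ℕ} {k : ℤ} (f : CuspSpace N k) (d : ℕ+) :
    slash k f (matV d) ∣[k] ModularGroup.T = slash k f (matV d) :=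
  slash_matV_invariant (fun _ ↦ f.slash_eq) d (T_mem_Gamma0 _)

/-- The inner products `⟨f, f | V(2 ^ l)⟩` for an eigenform `f` of the operator `U(2)`. -/
lemma petInner_matV_two_pow {N : ℕ} [NeZero N] {k : ℤ} (f : CuspSpace N k) {μ : ℂ}
    (hμ : slash k f (matB 0 2) + slash k f (matB 1 2) = μ • (f : ℍ → ℂ)) (l : ℕ) :
    petInner k f (slash k f (matV (2 ^ l))) = (μ / 2) ^ l * petInner k f f := by
  induction l with
  | zero => rw [pow_zero, slash_matV_one, pow_zero, one_mul]
  | succ l ih =>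
    have h := petInner_sum_matB f.isForm (f.isForm.slash_matV (2 ^ l)) (slash_matV_T f (2 ^ l))
    rw [hμ, petInner_smul_left f.isForm (f.isForm.slash_matV _), ih, ← slash_matV_mul,
      ← pow_succ] at h
    rw [pow_succ (μ / 2)]
    linear_combination -h / 2

lemma two_rpow_ne_zero (x : ℝ) : (((2 : ℝ) ^ x : ℝ) : ℂ) ≠ 0 := by
  exact_mod_cast (Real.rpow_pos_of_pos two_pos x).ne'

lemma IsNormalizedNewform.exists_sum_matB_eq {N : ℕ} {k : ℤ} {f : CuspSpace N k}
    (hf : IsNormalizedNewform N k f) (hN : 2 ∣ N) :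
    ∃ μ : ℂ, slash k f (matB 0 2) + slash k f (matB 1 2) = μ • (f : ℍ → ℂ) := by
  obtain ⟨c, hc⟩ := hf.eigen 2 Nat.prime_two
  rw [heckeT_two, if_pos hN, add_zero] at hc
  refine ⟨(((2 : ℝ) ^ ((k : ℝ) / 2 - 1) : ℝ) : ℂ)⁻¹ * c, ?_⟩
  rw [mul_smul, ← hc, inv_smul_smul₀ (two_rpow_ne_zero _)]

lemma IsNormalizedNewform.ne_zero {N : ℕ} {k : ℤ} {f : CuspSpace N k}
    (hf : IsNormalizedNewform N k f) : (f : ℍ → ℂ) ≠ 0 := by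
  intro h
  have := hf.normalized
  rw [coeff, h, qExpansion_zero] at this
  simp at this

/-! ### Newforms of levels 4 and 2 -/

/-- A newform of level `4` is annihilated by `U(2)`. -/
lemma IsNormalizedNewform.sum_matB_eq_zero {k : ℤ} {f : CuspSpace 4 k}
    (hf : IsNormalizedNewform 4 k f) {μ : ℂ}
    (hμ : slash k f (matB 0 2) + slash k f (matB 1 2) = μ • (f : ℍ → ℂ)) : μ = 0 := by
  by_contra hne
  have hinv : ∀ γ ∈ Gamma0 2, (f : ℍ → ℂ) ∣[k] γ = f := by
    intro γ hγ
    have h := sum_matB_invariant (fun γ ↦ f.slash_eq) hγ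
    rw [hμ, ModularForm.SL_smul_slash] at h
    exact smul_right_injective _ hne h
  obtain ⟨F, hF⟩ := f.isForm.exists_cuspForm hinv
  have hold : (f : ℍ → ℂ) ∈ oldSpace 4 k :=
    Submodule.subset_span ⟨2, 1, F, by norm_num, by norm_num, by rw [slash_matV_one, hF]⟩
  have h := hf.new _ hold
  rw [pet_Gamma0_eq_petInner] at h
  exact hf.ne_zero (eq_zero_of_petInner_self f.isForm h)

/-- The trace to level `1` of the image under `W₂` of a newform of level `2` vanishes. -/
lemma IsNormalizedNewform.trace_eq_zero {k : ℤ} {f : CuspSpace 2 k}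
    (hf : IsNormalizedNewform 2 k f) :
    slash k f (matB 0 2) + slash k f (matB 1 2) + slash k f (matW 2) = 0 := by
  -- The three matrices are, up to `Γ₀(2)` on the left, the products of `W_2` with coset
  -- representatives of `Γ₀(2)` in `SL(2, ℤ)`. `S` swaps the first and third terms, `T` the first
  -- two, and each fixes the remaining one.
  set h : ℍ → ℂ := slash k f (matB 0 2) + slash k f (matB 1 2) + slash k f (matW 2) with hh
  have mem2 : ∀ γ : SL(2, ℤ), (2 : ℤ) ∣ γ 1 0 → (f : ℍ → ℂ) ∣[k] γ = f := fun γ hγ ↦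
    f.slash_eq (Gamma0_mem.mpr ((ZMod.intCast_zmod_eq_zero_iff_dvd _ _).mpr hγ))
  have hWS : slash k f (matW 2) ∣[k] ModularGroup.S = slash k f (matB 0 2) :=
    slash_slash_SL (γ' := -1) (det_pos_matW _) (det_pos_matB _ _) (mem2 _ (by simp)) (by
      rw [mapGL_val, mapGL_val, matW_val, matB_val]; simp [ModularGroup.S])
  let γS : SL(2, ℤ) := ⟨!![1, -1; 2, -1], by simp [Matrix.det_fin_two_of]⟩
  let γT : SL(2, ℤ) := ⟨!![1, 0; -2, 1], by simp [Matrix.det_fin_two_of]⟩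
  have hBS : slash k f (matB 1 2) ∣[k] ModularGroup.S = slash k f (matB 1 2) :=
    slash_slash_SL (γ' := γS) (det_pos_matB _ _) (det_pos_matB _ _) (mem2 _ (by simp [γS])) (by
      rw [mapGL_val, mapGL_val, matB_val]; simp [γS, ModularGroup.S]; norm_num)
  have hWT : slash k f (matW 2) ∣[k] ModularGroup.T = slash k f (matW 2) :=
    slash_slash_SL (γ' := γT) (det_pos_matW _) (det_pos_matW _) (mem2 _ (by simp [γT])) (by
      rw [mapGL_val, mapGL_val, matW_val]; simp [γT, ModularGroup.T])
  have hBT : slash k f (matB 1 2) ∣[k] ModularGroup.T = slash k f (matB 0 2) :=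
    slash_slash_SL (γ' := ModularGroup.T) (det_pos_matB _ _) (det_pos_matB _ _)
      (f.slash_eq (T_mem_Gamma0 2)) (by
      rw [mapGL_val, matB_val, matB_val]; simp [ModularGroup.T]; norm_num)
  have hS : h ∣[k] ModularGroup.S = h := by
    rw [hh, SlashAction.add_slash, SlashAction.add_slash, slash_matB_zero_S, hBS, hWS]
    abel
  have hT : h ∣[k] ModularGroup.T = h := by
    rw [hh, SlashAction.add_slash, SlashAction.add_slash, slash_matB_zero_T, hBT, hWT]
    abel
  have hform : IsForm k h :=
    ((f.isForm.slash_matB 0 2).add (f.isForm.slash_matB 1 2)).add (f.isForm.slash_matW 2)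
  obtain ⟨F, hF⟩ := hform.exists_cuspForm (Γ := Gamma0 1) fun γ _ ↦ invariant_SL_of_S_T hS hT γ
  have hnew : petInner k f (slash k h (matV 2)) = 0 := by
    rw [← hF, ← hf.new (slash k F (matV 2))
      (Submodule.subset_span ⟨1, 2, F, by norm_num, by norm_num, rfl⟩)]
    refine (pet_eq_petInner (fun γ ↦ f.slash_eq) fun γ hγ ↦ ?_).symm
    exact slash_matV_invariant (N := 1) (fun _ ↦ CuspSpace.slash_eq F) 2 (by simpa using hγ)
  refine eq_zero_of_petInner_self hform ?_
  -- By invariance of `h` under `S`, the third term pairs with `h` like the first, so `⟨h, h⟩ = 3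
  -- ⟨f, h | V(2)⟩`, which is zero by newness.
  have hW : petInner k (slash k f (matW 2)) h = petInner k f (slash k h (matV 2)) := by
    rw [← slash_matB_zero_S, ← petInner_matB_zero f.isForm hform]
    nth_rw 1 [← hS]
    exact petInner_slash_SL (f.isForm.slash_matB 0 2) hform _
  nth_rw 1 [hh]
  rw [petInner_add_left ((f.isForm.slash_matB 0 2).add (f.isForm.slash_matB 1 2))
    (f.isForm.slash_matW 2) hform, hW, petInner_sum_matB f.isForm hform hT, hnew]
  simp

/-- `W_2 ^ 2` is the scalar `-2`: its sign lies in `Γ₀(2)`, and positive scalars act trivially. -/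
lemma slash_matW_two_matW_two {k : ℤ} (f : CuspSpace 2 k) :
    slash k (slash k f (matW 2)) (matW 2) = f := by
  have h : matW 2 * matW 2 = mapGL ℝ (-1 : SL(2, ℤ)) * (matB 0 2 * matV 2) := by
    refine Units.ext ?_
    rw [Units.val_mul, Units.val_mul, Units.val_mul, mapGL_val, matB_val, matV_val, matW_val]
    simp
  have hBV : 0 < (matB 0 2 * matV 2).det.val := by
    rw [map_mul, Units.val_mul]
    exact mul_pos (det_pos_matB 0 2) (det_pos_matV 2)
  rw [← slash_mul k f (det_pos_matW 2) (det_pos_matW 2), h,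
    slash_mul k f (det_pos_mapGL _) hBV, slash_SL, f.slash_eq (by simp [Gamma0_mem]),
    slash_mul k f (det_pos_matB 0 2) (det_pos_matV 2), slash_matB_zero_matV]

/-! ### Level 1 and the main theorem -/

/-- The recursion for the inner products `⟨f, f | V(2 ^ l)⟩` in level `1`. -/
lemma petInner_levelOne_recursion {k : ℤ} (f : CuspSpace 1 k) {μ : ℂ}
    (hμ : slash k f (matB 0 2) + slash k f (matB 1 2) + slash k f (matV 2) = μ • (f : ℍ → ℂ)) :
    3 * petInner k f (slash k f (matV 2)) = μ * petInner k f f ∧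
    ∀ d : ℕ+, 2 * petInner k f (slash k f (matV (d * 2 * 2))) =
      μ * petInner k f (slash k f (matV (d * 2))) - petInner k f (slash k f (matV d)) := by
  have hf := f.isForm
  have key : ∀ g, IsForm k g → g ∣[k] ModularGroup.T = g →
      2 * petInner k f (slash k g (matV 2)) + petInner k (slash k f (matV 2)) g =
        μ * petInner k f g := by
    intro g hg hT
    rw [← petInner_sum_matB hf hg hT, ← petInner_add_left
      ((hf.slash_matB 0 2).add (hf.slash_matB 1 2)) (hf.slash_matV 2) hg, hμ,
      petInner_smul_left hf hg]
  constructor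
  · have h := key f hf (f.slash_eq (mem_Gamma0_one _))
    -- At level 1, `V(2) S = S (1 0; 0 2)`; hence `⟨f | V(2), f⟩ = ⟨f, f | V(2)⟩`, which turns the
    -- coefficient 2 into 3.
    have hVS : slash k f (matV 2) ∣[k] ModularGroup.S = slash k f (matB 0 2) :=
      slash_slash_SL (γ' := ModularGroup.S) (det_pos_matV _) (det_pos_matB _ _)
        (f.slash_eq (mem_Gamma0_one _)) (by
        rw [mapGL_val, matV_val, matB_val]; simp [ModularGroup.S])
    have e : petInner k (slash k f (matV 2)) f = petInner k f (slash k f (matV 2)) := by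
      rw [← petInner_slash_SL (hf.slash_matV 2) hf ModularGroup.S, hVS,
        f.slash_eq (mem_Gamma0_one _), petInner_matB_zero hf hf]
    rw [e] at h
    linear_combination h
  · intro d
    have h := key _ (hf.slash_matV (d * 2)) (slash_matV_T f (d * 2))
    rw [← slash_matV_mul] at h
    -- A common factor `V(2)` cancels from both arguments.
    have e : petInner k (slash k f (matV 2)) (slash k f (matV (d * 2))) =
        petInner k f (slash k f (matV d)) := by
      rw [slash_matV_mul k f d 2]
      exact petInner_slash hf (hf.slash_matV d) (matV_mem_ratGL 2) (det_pos_matV 2)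
    rw [e] at h
    linear_combination h

lemma two_pow_rpow (n : ℕ) (x : ℝ) : ((2 : ℝ) ^ n) ^ x = (2 ^ x) ^ n := by
  rw [← Real.rpow_natCast, ← Real.rpow_natCast, ← Real.rpow_mul two_pos.le,
    ← Real.rpow_mul two_pos.le, mul_comm]

end VNewform

end

theorem mainTheorem6 (k : ℤ) (hk : 0 < k) :
    -- level 4
    (∀ f : VNewform.CuspSpace 4 k, VNewform.IsNormalizedNewform 4 k f →
      ∀ l : ℕ, 1 ≤ l → VNewform.petV 4 k f (2 ^ l) = 0) ∧
    -- level 2; the number `ε` is the eigenvalue of `f` under the Fricke involution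
    (∀ f : VNewform.CuspSpace 2 k, VNewform.IsNormalizedNewform 2 k f →
      ∃ ε : ℂ, (ε = 1 ∨ ε = -1) ∧
        VNewform.slash k f (VNewform.matW 2) = ε • (f : UpperHalfPlane → ℂ) ∧
        ∀ l : ℕ, VNewform.petV 2 k f (2 ^ l) =
          (-ε / 2) ^ l * VNewform.pet (CongruenceSubgroup.Gamma0 2) k f f) ∧
    -- level 1
    (∀ f : VNewform.CuspSpace 1 k, VNewform.IsNormalizedNewform 1 k f →
      VNewform.petV 1 k f 2 =
        (1 / 3 * (VNewform.coeff f 2 / (((2 : ℝ) ^ ((k : ℝ) / 2 - 1) : ℝ) : ℂ))) *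
          VNewform.pet (CongruenceSubgroup.Gamma0 1) k f f ∧
      VNewform.petV 1 k f 4 =
        (1 / 6 * (VNewform.coeff f 2 ^ 2 / (((4 : ℝ) ^ ((k : ℝ) / 2 - 1) : ℝ) : ℂ)) - 1 / 2) *
          VNewform.pet (CongruenceSubgroup.Gamma0 1) k f f ∧
      VNewform.petV 1 k f 8 =
        (1 / 12 * (VNewform.coeff f 2 ^ 3 / (((8 : ℝ) ^ ((k : ℝ) / 2 - 1) : ℝ) : ℂ)) -
          5 / 12 * (VNewform.coeff f 2 / (((2 : ℝ) ^ ((k : ℝ) / 2 - 1) : ℝ) : ℂ))) *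
          VNewform.pet (CongruenceSubgroup.Gamma0 1) k f f ∧
      VNewform.petV 1 k f 16 =
        (1 / 24 * (VNewform.coeff f 2 ^ 4 / (((16 : ℝ) ^ ((k : ℝ) / 2 - 1) : ℝ) : ℂ)) -
          7 / 24 * (VNewform.coeff f 2 ^ 2 / (((4 : ℝ) ^ ((k : ℝ) / 2 - 1) : ℝ) : ℂ)) + 1 / 4) *
          VNewform.pet (CongruenceSubgroup.Gamma0 1) k f f) := by
  open VNewform in
  refine ⟨fun f hf l hl ↦ ?_, fun f hf ↦ ?_, fun f hf ↦ ?_⟩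
  · obtain ⟨μ, hμ⟩ := hf.exists_sum_matB_eq (by norm_num)
    rw [petV_eq_petInner, petInner_matV_two_pow f hμ, hf.sum_matB_eq_zero hμ, zero_div,
      zero_pow (by omega), zero_mul]
  · obtain ⟨μ, hμ⟩ := hf.exists_sum_matB_eq (dvd_refl 2)
    have hW : slash k f (matW 2) = (-μ) • (f : UpperHalfPlane → ℂ) := by
      have h := hf.trace_eq_zero
      rw [hμ] at h
      ext τ
      have hτ := congrFun h τ
      simp only [Pi.add_apply, Pi.smul_apply, Pi.zero_apply, smul_eq_mul] at hτ ⊢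
      linear_combination hτ
    refine ⟨-μ, ?_, hW, fun l ↦ ?_⟩
    -- The involution forces `(-μ) ^ 2 = 1`, because `f ≠ 0`.
    · have h := slash_matW_two_matW_two f
      rw [hW, slash_smul, hW, smul_smul] at h
      refine mul_self_eq_one_iff.mp ?_
      by_contra hne
      refine hf.ne_zero ((smul_eq_zero.mp ?_).resolve_left (sub_ne_zero.mpr hne))
      rw [sub_smul, one_smul, h, sub_self]
    · rw [petV_eq_petInner, petInner_matV_two_pow f hμ, pet_Gamma0_eq_petInner, neg_neg]
  · obtain ⟨c, hc⟩ := hf.eigen 2 Nat.prime_two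
    have hcoeff := heckeT_two_eigenvalue (by norm_num) f hc
    rw [hf.normalized, mul_one] at hcoeff
    have hr := two_rpow_ne_zero ((k : ℝ) / 2 - 1)
    have h4 : ((4 : ℝ) ^ ((k : ℝ) / 2 - 1)) = ((2 : ℝ) ^ ((k : ℝ) / 2 - 1)) ^ 2 := by
      rw [← two_pow_rpow]; norm_num
    have h8 : ((8 : ℝ) ^ ((k : ℝ) / 2 - 1)) = ((2 : ℝ) ^ ((k : ℝ) / 2 - 1)) ^ 3 := by
      rw [← two_pow_rpow]; norm_num
    have h16 : ((16 : ℝ) ^ ((k : ℝ) / 2 - 1)) = ((2 : ℝ) ^ ((k : ℝ) / 2 - 1)) ^ 4 := by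
      rw [← two_pow_rpow]; norm_num
    rw [h4, h8, h16, ← hcoeff]
    set r : ℂ := (((2 : ℝ) ^ ((k : ℝ) / 2 - 1) : ℝ) : ℂ) with hrdef
    simp only [Complex.ofReal_pow, ← hrdef, ← div_pow]
    rw [heckeT_two, if_neg (by norm_num)] at hc
    obtain ⟨h1, hrec⟩ := petInner_levelOne_recursion f (μ := c / r) (by
      rw [div_eq_inv_mul, mul_smul, ← hc, inv_smul_smul₀ hr])
    have r1 := hrec 1
    have r2 := hrec 2
    have r3 := hrec 4
    rw [show (1 * 2 * 2 : ℕ+) = 4 from rfl, show (1 * 2 : ℕ+) = 2 from rfl,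
      slash_matV_one] at r1
    rw [show (2 * 2 * 2 : ℕ+) = 8 from rfl, show (2 * 2 : ℕ+) = 4 from rfl] at r2
    rw [show (4 * 2 * 2 : ℕ+) = 16 from rfl, show (4 * 2 : ℕ+) = 8 from rfl] at r3
    simp only [petV_eq_petInner, pet_Gamma0_eq_petInner]
    generalize c / r = μ at *
    -- With `x_l ⟨f, f⟩ = ⟨f, f | V(2 ^ l)⟩`, this unwinds `3 x_1 = μ` and `2 x_{l+2} = μ x_{l+1} -
    -- x_l` from `x_0 = 1`.
    refine ⟨by linear_combination h1 / 3, by linear_combination r1 / 2 + μ / 6 * h1, ?_, ?_⟩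
    · linear_combination r2 / 2 + μ / 4 * r1 + (μ ^ 2 / 12 - 1 / 6) * h1
    · linear_combination r3 / 2 + μ / 4 * r2 + (μ ^ 2 / 8 - 1 / 4) * r1 +
        (μ / 2 * (μ ^ 2 / 12 - 1 / 6) - μ / 12) * h1
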